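/- Let $\mathbb H=\{(z_1,z_2)\in\mathbb C^2:|z_1|<|z_2|<1\}$ be the Hartogs triangle, with Lebesgue measure $dV$; write $|U|$ for the Lebesgue measure of $U$. Let $A^2(\mathbb H)$ be the space of holomorphic functions in $L^2(\mathbb H)$. The orthogonal projection $L^2(\mathbb H)\to A^2(\mathbb H)$ (the Bergman projection) is given by a kernel $K_{\mathbb H}$, the Bergman kernel: $$P(f)(z)=\int_{\mathbb H}K_{\mathbb H}(z;\bar w)f(w)\,dV(w),\qquad z\in\mathbb H, \tag{1}$$ for all $f\in L^2(\mathbb H)$. For other functions $f$ on $\mathbb H$, $P(f)$ is defined by (1) whenever the integral converges absolutely for every $z\in\mathbb H$. For $0<|z|<1$ put $h_1(z)=-\log|z|+1$ and $h_{j+1}(z)=\log(h_j(z)+1)+1$ for $j\ge 1$, and for $\alpha\in\mathbb R$ and an integer $j\ge1$ put $$f_{\alpha,j}(z)=|z|^{-2}\,h_j(z)^{\alpha}\prod_{k=1}^{j-1}h_k(z)^{-1}.$$ **Theorem.** Let $\alpha<-1$ and let $j\ge1$ be an integer. There is a constant $C$, depending only on $\alpha$ and $j$, such that for every measurable $f:\mathbb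 H\to\mathbb C$ with $$\|f\|^{4/3}:=\int_{\mathbb H}|f(z)|^{4/3}\bigl(|z_2|^{2}f_{\alpha,j}(z_2)\bigr)^{-1/3}\,dV(z)<\infty,$$ the integral (1) converges absolutely for every $z\in\mathbb H$, $P(f)$ is measurable on $\mathbb H$, and for all $\lambda>0$ $$\bigl|\{z\in\mathbb H:|P(f)(z)|>\lambda\}\bigr|\le C\,\frac{\|f\|^{4/3}}{\lambda^{4/3}}.$$ -/

import Mathlib

open MeasureTheory
open scoped ENNReal NNReal

noncomputable section

/-- The Hartogs triangle `{(z₁, z₂) ∈ ℂ² : |z₁| < |z₂| < 1}`. -/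
def hartogsTriangle : Set (ℂ × ℂ) := {z | ‖z.1‖ < ‖z.2‖ ∧ ‖z.2‖ < 1}

/-- The Bergman space `A²(Ω)`: functions holomorphic on `Ω` and square-integrable on `Ω`
with respect to Lebesgue measure. Values off `Ω` play no role. -/
def bergmanSpace (Ω : Set (ℂ × ℂ)) : Set (ℂ × ℂ → ℂ) :=
  {g | DifferentiableOn ℂ g Ω ∧ MemLp g 2 (volume.restrict Ω)}

/-- `g` is (the holomorphic representative of) the orthogonal projection of `f ∈ L²(Ω)`
onto `A²(Ω)`: `g ∈ A²(Ω)` and `f - g` is orthogonal to `A²(Ω)`. -/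
def IsBergmanProjectionOf (Ω : Set (ℂ × ℂ)) (f g : ℂ × ℂ → ℂ) : Prop :=
  g ∈ bergmanSpace Ω ∧
    ∀ h ∈ bergmanSpace Ω, ∫ w in Ω, (f w - g w) * (starRingEnd ℂ) (h w) = 0

/-- `K` is the integral kernel of the orthogonal projection `L²(Ω) → A²(Ω)`: for every
`f ∈ L²(Ω)` the function `z ↦ ∫_Ω K(z, w) f(w) dV(w)` is given by absolutely convergent
integrals at all points of `Ω` and is the orthogonal projection of `f` onto `A²(Ω)`. For open `Ω`
this determines `K z w`, for each `z ∈ Ω`, up to a null set of `w ∈ Ω`. -/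
def IsBergmanKernel (Ω : Set (ℂ × ℂ)) (K : ℂ × ℂ → ℂ × ℂ → ℂ) : Prop :=
  ∀ f : ℂ × ℂ → ℂ, MemLp f 2 (volume.restrict Ω) →
    (∀ z ∈ Ω, IntegrableOn (fun w => K z w * f w) Ω) ∧
      IsBergmanProjectionOf Ω f (fun z => ∫ w in Ω, K z w * f w)

/-- The Bergman kernel of `Ω` (meaningful when there is one). -/
def bergmanKernel (Ω : Set (ℂ × ℂ)) : ℂ × ℂ → ℂ × ℂ → ℂ :=
  Classical.epsilon fun K => IsBergmanKernel Ω K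

/-- The Bergman projection as an integral operator:
`P f (z) = ∫_Ω K_Ω(z, w) f(w) dV(w)`. -/
def bergmanProjection (Ω : Set (ℂ × ℂ)) (f : ℂ × ℂ → ℂ) (z : ℂ × ℂ) : ℂ :=
  ∫ w in Ω, bergmanKernel Ω z w * f w

/-- The iterated logarithms `h₁ = -log |z| + 1`, `h_{j+1} = log (h_j + 1) + 1` for `j ≥ 1`.
The value at index `0` is a placeholder. -/
def iterLog : ℕ → ℂ → ℝ
  | 0, _ => 1
  | 1, z => -Real.log ‖z‖ + 1
  | j + 2, z => Real.log (iterLog (j + 1) z + 1) + 1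

/-- `f_{α,j}(z) = |z|⁻² h_j(z)^α ∏_{1 ≤ k < j} h_k(z)⁻¹`, for `j ≥ 1`. -/
def logWeight (α : ℝ) (j : ℕ) (z : ℂ) : ℝ :=
  (‖z‖ ^ 2)⁻¹ * iterLog j z ^ α * ∏ k ∈ Finset.Ico 1 j, (iterLog k z)⁻¹

/-- The measure `(|z₂|² f_{α,j}(z₂))^{-1/3} dV` on the Hartogs triangle. -/
def hartogsWeightedMeasure (α : ℝ) (j : ℕ) : Measure (ℂ × ℂ) :=
  (volume.restrict hartogsTriangle).withDensity fun z =>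
    ENNReal.ofReal ((‖z.2‖ ^ 2 * logWeight α j z.2) ^ (-(1 / 3) : ℝ))

end

/-! ### Polar coordinates on the unit disc. -/

section Polar
open Metric Set Real

/-! The map `(u, v) ↦ (u v, v)` carries D × D* onto the Hartogs triangle with real Jacobian `|v|²`,
so `f ↦ F(u, v) = v f(u v, v)` is unitary from L² of the triangle to L² of the bidisc and preserves
holomorphy on D × D*. A square-integrable holomorphic function extends across `v = 0`, so the
Bergman projection of the triangle is conjugate to that of the bidisc, and its kernel is `(z₂
w̄₂)⁻¹` times the bidisc kernel at `(z₁/z₂, z₂)`, `(w₁/w₂, w₂)`.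

Write `L` for `logWeight α j`. Since `|v|² · |v|^(-2/3) = |v|^(4/3)`, the weighted norm of `f`
becomes `∫ |F|^(4/3) L(v)^(-1/3)`. Since `|v|^(2 - 4/3) ≤ 1`, the L^(4/3) norm of the projection of
`f` is at most that of the bidisc projection of `F`. What remains is an estimate on the bidisc, from
the weighted to the unweighted L^(4/3). It is of strong type; the weak-type bound follows by
Chebyshev.

The bidisc estimate is a Schur test with the absolute value of the kernel, and product weights
reduce it to one disc at a time. Let `δ = 1 - |w|²`. In `u` the test functions are powers of `δ`, by
the Forelli–Rudin estimate. In `v` they satisfy `U⁴ = δ^(-3/4) + L` and `V⁴ = δ^(-3/4)`. The only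
property of `L` at the origin that is used is integrability. It holds because `α < -1`: up to
bounded factors, `|v| L(v)` is the radial derivative of a multiple of `h_j^(α+1)`, which stays
bounded at `0`. The same integrability and Hölder put `F` in L¹, so the defining integrals converge
absolutely. -/

theorem complex_polarCoord_symm_eq_circleMap (p : ℝ × ℝ) :
    Complex.polarCoord.symm p = circleMap 0 p.1 p.2 := by
  simp [circleMap, Complex.exp_mul_I]

theorem norm_circleMap_mem_ball {r : ℝ} (hr : r ∈ Ioo (0 : ℝ) 1) (θ : ℝ) :
    circleMap 0 r θ ∈ ball (0 : ℂ) 1 := by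
  simp [abs_of_pos hr.1, hr.2]

theorem polar_indicator {E : Type*} [Zero E] (g : ℂ → E) (p : ℝ × ℝ)
    (hp : p ∈ polarCoord.target) :
    (ball (0 : ℂ) 1).indicator g (Complex.polarCoord.symm p)
      = (Ioo (0 : ℝ) 1 ×ˢ Ioo (-π) π).indicator (fun p => g (circleMap 0 p.1 p.2)) p := by
  rw [complex_polarCoord_symm_eq_circleMap]
  have hp' : 0 < p.1 ∧ -π < p.2 ∧ p.2 < π := by simpa [polarCoord_target] using hp
  by_cases h : p.1 < 1
  · rw [indicator_of_mem (norm_circleMap_mem_ball ⟨hp'.1, h⟩ _),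
      indicator_of_mem (by simp [hp', h])]
  · rw [indicator_of_notMem (by simpa [abs_of_pos hp'.1] using h), indicator_of_notMem (by simp [h])]

theorem unitDisk_polar_inter :
    (Ioo (0 : ℝ) 1 ×ˢ Ioo (-π) π) ∩ polarCoord.target = Ioo (0 : ℝ) 1 ×ˢ Ioo (-π) π := by
  rw [inter_eq_left, polarCoord_target]
  exact prod_mono (fun x hx => hx.1) subset_rfl

theorem setLIntegral_unitDisk_polar_prod (g : ℂ → ℝ≥0∞) :
    ∫⁻ w in ball (0 : ℂ) 1, g w = ∫⁻ p in Ioo (0 : ℝ) 1 ×ˢ Ioo (-π) π,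
      ENNReal.ofReal p.1 * g (circleMap 0 p.1 p.2) := by
  rw [← lintegral_indicator measurableSet_ball, ← Complex.lintegral_comp_polarCoord_symm]
  have : ∀ p ∈ polarCoord.target, ENNReal.ofReal p.1 •
      (ball (0 : ℂ) 1).indicator g (Complex.polarCoord.symm p) =
      (Ioo (0 : ℝ) 1 ×ˢ Ioo (-π) π).indicator
        (fun p => ENNReal.ofReal p.1 * g (circleMap 0 p.1 p.2)) p := fun p hp => by
    rw [polar_indicator g p hp]
    simp [indicator]
  rw [setLIntegral_congr_fun polarCoord.open_target.measurableSet this,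
    lintegral_indicator (measurableSet_Ioo.prod measurableSet_Ioo),
    Measure.restrict_restrict (measurableSet_Ioo.prod measurableSet_Ioo), unitDisk_polar_inter]

theorem setIntegral_unitDisk_polar_prod (g : ℂ → ℂ) :
    ∫ w in ball (0 : ℂ) 1, g w = ∫ p in Ioo (0 : ℝ) 1 ×ˢ Ioo (-π) π,
      p.1 • g (circleMap 0 p.1 p.2) := by
  rw [← integral_indicator measurableSet_ball, ← Complex.integral_comp_polarCoord_symm]
  have : ∀ p ∈ polarCoord.target, p.1 •
      (ball (0 : ℂ) 1).indicator g (Complex.polarCoord.symm p) =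
      (Ioo (0 : ℝ) 1 ×ˢ Ioo (-π) π).indicator
        (fun p => p.1 • g (circleMap 0 p.1 p.2)) p := fun p hp => by
    rw [polar_indicator g p hp]
    simp [indicator]
  rw [setIntegral_congr_fun polarCoord.open_target.measurableSet this,
    integral_indicator (measurableSet_Ioo.prod measurableSet_Ioo),
    Measure.restrict_restrict (measurableSet_Ioo.prod measurableSet_Ioo), unitDisk_polar_inter]

theorem measurable_circleMap_prod : Measurable fun p : ℝ × ℝ => circleMap 0 p.1 p.2 := by
  have : Continuous fun p : ℝ × ℝ => circleMap 0 p.1 p.2 := by unfold circleMap; fun_prop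
  exact this.measurable

theorem setLIntegral_unitDisk_polar {g : ℂ → ℝ≥0∞} (hg : Measurable g) :
    ∫⁻ w in ball (0 : ℂ) 1, g w = ∫⁻ r in Ioo (0 : ℝ) 1, ENNReal.ofReal r *
      ∫⁻ θ in Ioo (-π) π, g (circleMap 0 r θ) := by
  rw [setLIntegral_unitDisk_polar_prod, Measure.volume_eq_prod, ← Measure.prod_restrict,
    lintegral_prod]
  · refine lintegral_congr fun r => ?_
    exact lintegral_const_mul (ENNReal.ofReal r) (f := fun θ => g (circleMap 0 r θ))
      (hg.comp (measurable_circleMap 0 r))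
  · exact ((ENNReal.measurable_ofReal.comp measurable_fst).mul
      (hg.comp measurable_circleMap_prod)).aemeasurable

theorem circleAverage_eq_setIntegral {E : Type*} [NormedAddCommGroup E] [NormedSpace ℝ E]
    (f : ℂ → E) (r : ℝ) :
    circleAverage f 0 r = (2 * π)⁻¹ • ∫ θ in Ioo (-π) π, f (circleMap 0 r θ) := by
  rw [circleAverage]
  congr 1
  have hp : Function.Periodic (fun θ => f (circleMap 0 r θ)) (2 * π) := fun θ => by
    simp only [periodic_circleMap 0 r θ]
  have := hp.intervalIntegral_add_eq 0 (-π)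
  rw [zero_add, show -π + 2 * π = π by ring] at this
  rw [this, intervalIntegral.integral_of_le (by linarith [pi_pos]), integral_Ioc_eq_integral_Ioo]

/-- Continuity serves only to give measurability in the coordinates `(r, θ)`; integrability is
transferred through the lower integral. -/
theorem setIntegral_unitDisk_polar {g : ℂ → ℂ} (hc : ContinuousOn g (ball 0 1))
    (hg : IntegrableOn g (ball 0 1)) :
    ∫ w in ball (0 : ℂ) 1, g w =
      ∫ r in Ioo (0 : ℝ) 1, (2 * π * r) • circleAverage g 0 r := by
  have hm : MapsTo (fun p : ℝ × ℝ => circleMap 0 p.1 p.2) (Ioo (0 : ℝ) 1 ×ˢ Ioo (-π) π)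
      (ball (0 : ℂ) 1) := fun p hp => norm_circleMap_mem_ball hp.1 _
  have hcont : ContinuousOn (fun p : ℝ × ℝ => p.1 • g (circleMap 0 p.1 p.2))
      (Ioo (0 : ℝ) 1 ×ˢ Ioo (-π) π) := by
    refine continuousOn_fst.smul (hc.comp ?_ hm)
    unfold circleMap; fun_prop
  have hint : IntegrableOn (fun p : ℝ × ℝ => p.1 • g (circleMap 0 p.1 p.2))
      (Ioo (0 : ℝ) 1 ×ˢ Ioo (-π) π) := by
    refine ⟨hcont.aestronglyMeasurable (measurableSet_Ioo.prod measurableSet_Ioo), ?_⟩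
    have h2 := hg.2
    rw [HasFiniteIntegral, setLIntegral_unitDisk_polar_prod] at h2
    rw [HasFiniteIntegral]
    refine lt_of_eq_of_lt (setLIntegral_congr_fun (measurableSet_Ioo.prod measurableSet_Ioo)
      fun p hp => ?_) h2
    simp only [enorm_smul]
    rw [Real.enorm_eq_ofReal hp.1.1.le]
  rw [setIntegral_unitDisk_polar_prod, Measure.volume_eq_prod, setIntegral_prod]
  · refine setIntegral_congr_fun measurableSet_Ioo fun r hr => ?_
    simp only
    rw [circleAverage_eq_setIntegral, integral_smul, smul_smul]
    congr 1
    field_simp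
  · exact hint
end Polar

/-! ### The Bergman kernel of the disc: circle integrals and the reproducing property. -/

section Disk
open Metric Set Real

/-- The Bergman kernel of the unit disc. -/
noncomputable def diskKernel (z w : ℂ) : ℂ := ((π : ℂ) * (1 - z * starRingEnd ℂ w) ^ 2)⁻¹

theorem one_sub_norm_le_norm_one_sub_mul_conj (z : ℂ) {w : ℂ} (hw : ‖w‖ ≤ 1) :
    1 - ‖z‖ ≤ ‖1 - z * starRingEnd ℂ w‖ := by
  have h1 : ‖z * starRingEnd ℂ w‖ ≤ ‖z‖ := by
    rw [norm_mul, RCLike.norm_conj]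
    exact mul_le_of_le_one_right (norm_nonneg _) hw
  have h2 := norm_sub_norm_le (1 : ℂ) (z * starRingEnd ℂ w)
  rw [norm_one] at h2
  linarith

theorem one_sub_mul_conj_ne_zero {z w : ℂ} (hz : ‖z‖ < 1) (hw : ‖w‖ ≤ 1) :
    1 - z * starRingEnd ℂ w ≠ 0 := by
  have := one_sub_norm_le_norm_one_sub_mul_conj z hw
  rw [← norm_pos_iff]; linarith

theorem norm_diskKernel (z w : ℂ) :
    ‖diskKernel z w‖ = (π * ‖1 - z * starRingEnd ℂ w‖ ^ 2)⁻¹ := by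
  simp [diskKernel, abs_of_pos pi_pos]

theorem norm_diskKernel_le {z w : ℂ} (hz : ‖z‖ < 1) (hw : ‖w‖ ≤ 1) :
    ‖diskKernel z w‖ ≤ (π * (1 - ‖z‖) ^ 2)⁻¹ := by
  rw [norm_diskKernel]
  have h := one_sub_norm_le_norm_one_sub_mul_conj z hw
  have h0 : 0 < 1 - ‖z‖ := by linarith
  have := pi_pos
  gcongr

theorem conj_diskKernel (z w : ℂ) : starRingEnd ℂ (diskKernel z w) = diskKernel w z := by
  simp [diskKernel, mul_comm]

theorem measurable_diskKernel : Measurable fun p : ℂ × ℂ => diskKernel p.1 p.2 := by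
  unfold diskKernel
  have : Continuous fun p : ℂ × ℂ => ((π : ℂ) * (1 - p.1 * starRingEnd ℂ p.2) ^ 2) :=
    continuous_const.mul ((continuous_const.sub
      (continuous_fst.mul (Complex.continuous_conj.comp continuous_snd))).pow 2)
  exact this.measurable.inv

theorem measurable_diskKernel_right (z : ℂ) : Measurable (diskKernel z) :=
  measurable_diskKernel.of_uncurry_left (f := diskKernel)

theorem continuousOn_diskKernel_right {z : ℂ} (hz : ‖z‖ < 1) :
    ContinuousOn (diskKernel z) (closedBall 0 1) := by
  unfold diskKernel
  refine ContinuousOn.inv₀ ?_ fun w hw => ?_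
  · exact (continuous_const.mul ((continuous_const.sub
      (continuous_const.mul Complex.continuous_conj)).pow 2)).continuousOn
  · have := one_sub_mul_conj_ne_zero hz (by simpa using hw : ‖w‖ ≤ 1)
    simp [this, pi_ne_zero]

/-- On `|w| = r` one has `w w̄ = r²`, hence `w - r² z = w (1 - z w̄)`. Thus the modulus of the
Bergman kernel on a circle is a multiple of a Poisson kernel. -/
theorem poissonKernel_circleMap {z : ℂ} {r : ℝ} (hr : 0 < r) {w : ℂ} (hw : ‖w‖ = r) :
    poissonKernel 0 (r ^ 2 * z) w = (1 - ‖z‖ ^ 2 * r ^ 2) / ‖1 - z * starRingEnd ℂ w‖ ^ 2 := by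
  have hw0 : w ≠ 0 := by rw [← norm_pos_iff, hw]; exact hr
  have h1 : w - r ^ 2 * z = w * (1 - z * starRingEnd ℂ w) := by
    have : w * starRingEnd ℂ w = (r : ℂ) ^ 2 := by
      rw [Complex.mul_conj, Complex.normSq_eq_norm_sq, hw]; push_cast; rfl
    linear_combination z * this
  simp only [poissonKernel, sub_zero]
  rw [h1, norm_mul, hw, norm_mul, norm_pow, Complex.norm_real, norm_of_nonneg hr.le,
    show r ^ 2 - (r ^ 2 * ‖z‖) ^ 2 = r ^ 2 * (1 - ‖z‖ ^ 2 * r ^ 2) by ring]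
  rw [mul_pow, hw, mul_div_mul_left]
  positivity

theorem norm_mul_sq_lt_one {z : ℂ} (hz : ‖z‖ < 1) {r : ℝ} (hr : r ∈ Ioo (0 : ℝ) 1) :
    ‖z‖ ^ 2 * r ^ 2 < 1 := by
  have h1 : ‖z‖ ^ 2 ≤ 1 := pow_le_one₀ (norm_nonneg _) hz.le
  have h2 : r ^ 2 < 1 := pow_lt_one₀ hr.1.le hr.2 two_ne_zero
  nlinarith [sq_nonneg r, sq_nonneg ‖z‖]

theorem mul_sq_mem_ball {z : ℂ} (hz : ‖z‖ < 1) {r : ℝ} (hr : r ∈ Ioo (0 : ℝ) 1) :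
    (r : ℂ) ^ 2 * z ∈ ball (0 : ℂ) r := by
  simp only [mem_ball_zero_iff, norm_mul, norm_pow, Complex.norm_real, norm_of_nonneg hr.1.le]
  nlinarith [hr.1, hr.2, norm_nonneg z, mul_pos hr.1 hr.1]

/-- The Poisson kernel at `r² z` has mean one over the circle of radius `r`, which evaluates the
integral exactly. -/
theorem lintegral_circle_diskKernel {z : ℂ} (hz : ‖z‖ < 1) {r : ℝ} (hr : r ∈ Ioo (0 : ℝ) 1) :
    ∫⁻ θ in Ioo (-π) π, ‖diskKernel z (circleMap 0 r θ)‖ₑ =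
      ENNReal.ofReal (2 / (1 - ‖z‖ ^ 2 * r ^ 2)) := by
  have hlt := norm_mul_sq_lt_one hz hr
  have hn : ∀ θ, ‖circleMap 0 r θ‖ = r := fun θ => by simp [abs_of_pos hr.1]
  have hav : circleAverage (poissonKernel 0 ((r : ℂ) ^ 2 * z) • fun _ => (1 : ℂ)) 0 r = 1 :=
    DiffContOnCl.circleAverage_poissonKernel_smul
      (DifferentiableOn.diffContOnCl (by fun_prop)) (mul_sq_mem_ball hz hr)
  rw [circleAverage_eq_setIntegral] at hav
  have hcont : Continuous fun θ => ‖diskKernel z (circleMap 0 r θ)‖ := by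
    refine ((continuousOn_diskKernel_right hz).comp_continuous (continuous_circleMap 0 r)
      fun θ => ?_).norm
    simpa [abs_of_pos hr.1] using hr.2.le
  have heq : ∀ θ, ((poissonKernel 0 ((r : ℂ) ^ 2 * z) • fun _ => (1 : ℂ)) (circleMap 0 r θ))
      = ((π * (1 - ‖z‖ ^ 2 * r ^ 2) * ‖diskKernel z (circleMap 0 r θ)‖ : ℝ) : ℂ) := fun θ => by
    simp only [Pi.smul_apply', poissonKernel_circleMap hr.1 (hn θ), norm_diskKernel]
    rw [Complex.real_smul, mul_one]
    congr 1
    have := pi_ne_zero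
    rw [mul_inv]
    field_simp
  simp_rw [heq] at hav
  rw [integral_complex_ofReal, integral_const_mul, Complex.real_smul] at hav
  have hav' : (2 * π)⁻¹ * (π * (1 - ‖z‖ ^ 2 * r ^ 2) *
      ∫ θ in Ioo (-π) π, ‖diskKernel z (circleMap 0 r θ)‖) = 1 := by exact_mod_cast hav
  simp_rw [← ofReal_norm]
  rw [← ofReal_integral_eq_lintegral_ofReal]
  · congr 1
    have := pi_ne_zero
    have h3 : (1 - ‖z‖ ^ 2 * r ^ 2) ≠ 0 := by linarith
    rw [eq_div_iff h3]
    field_simp at hav'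
    linarith
  · exact (hcont.integrableOn_Icc).mono_set Ioo_subset_Icc_self
  · exact Filter.Eventually.of_forall fun θ => norm_nonneg _

/-- With `w̄ = r²/w` on the circle, the integrand times `dw / w` is `π⁻¹ w F(w) (w - r² z)⁻² dw`,
and Cauchy's formula for the derivative of `w F(w)` applies. -/
theorem circleAverage_diskKernel_mul {F : ℂ → ℂ} (hF : DifferentiableOn ℂ F (ball 0 1)) {z : ℂ}
    (hz : ‖z‖ < 1) {r : ℝ} (hr : r ∈ Ioo (0 : ℝ) 1) :
    circleAverage (fun w => diskKernel z w * F w) 0 r =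
      (π : ℂ)⁻¹ * deriv (fun w => w * F w) (r ^ 2 * z) := by
  rw [circleAverage_eq_circleIntegral hr.1.ne',
    ← Complex.two_pi_I_inv_smul_circleIntegral_sub_sq_inv_smul_of_differentiable
      (f := fun w => w * F w) isOpen_ball
      (closedBall_subset_ball hr.2) (differentiableOn_id.mul hF) (mul_sq_mem_ball hz hr)]
  simp only [smul_eq_mul]
  rw [mul_left_comm, ← circleIntegral.integral_const_mul (π : ℂ)⁻¹]
  congr 1
  apply circleIntegral.integral_congr hr.1.le
  intro w hw
  have hw : ‖w‖ = r := by simpa using hw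
  have hw0 : w ≠ 0 := by rw [← norm_pos_iff, hw]; exact hr.1
  have h1 : w - r ^ 2 * z = w * (1 - z * starRingEnd ℂ w) := by
    have : w * starRingEnd ℂ w = (r : ℂ) ^ 2 := by
      rw [Complex.mul_conj, Complex.normSq_eq_norm_sq, hw]; push_cast; rfl
    linear_combination z * this
  have h2 := one_sub_mul_conj_ne_zero hz (hw.trans_le hr.2.le)
  have := pi_ne_zero
  simp only [h1, diskKernel, sub_zero]
  field_simp

theorem integrableOn_diskKernel_mul {F : ℂ → ℂ} (hF : IntegrableOn F (ball 0 1)) {z : ℂ}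
    (hz : ‖z‖ < 1) : IntegrableOn (fun w => diskKernel z w * F w) (ball 0 1) := by
  refine Integrable.bdd_mul hF (measurable_diskKernel_right z).aestronglyMeasurable
    (c := (π * (1 - ‖z‖) ^ 2)⁻¹) ?_
  filter_upwards [ae_restrict_mem measurableSet_ball] with w hw
  exact norm_diskKernel_le hz (by simpa using (mem_ball_zero_iff.1 hw).le)

/-- The Bergman kernel of the disc reproduces integrable holomorphic functions. -/
theorem setIntegral_diskKernel_mul {F : ℂ → ℂ} (hF : DifferentiableOn ℂ F (ball 0 1))
    (hFi : IntegrableOn F (ball 0 1)) {z : ℂ} (hz : ‖z‖ < 1) :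
    ∫ w in ball (0 : ℂ) 1, diskKernel z w * F w = F z := by
  rw [setIntegral_unitDisk_polar (g := fun w => diskKernel z w * F w)
    (((continuousOn_diskKernel_right hz).mono ball_subset_closedBall).mul hF.continuousOn)
    (integrableOn_diskKernel_mul hFi hz)]
  have h1 : ∀ r ∈ Ioo (0 : ℝ) 1, (2 * π * r) • circleAverage (fun w => diskKernel z w * F w) 0 r
      = 2 * (r : ℂ) * deriv (fun w => w * F w) (r ^ 2 * z) := fun r hr => by
    rw [circleAverage_diskKernel_mul hF hz hr, Complex.real_smul]
    have : (π : ℂ) ≠ 0 := by exact_mod_cast pi_ne_zero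
    push_cast
    field_simp
  rw [setIntegral_congr_fun measurableSet_Ioo h1, ← integral_Ioc_eq_integral_Ioo,
    ← intervalIntegral.integral_of_le zero_le_one]
  have hmem : ∀ r ∈ Icc (0 : ℝ) 1, (r : ℂ) ^ 2 * z ∈ ball (0 : ℂ) 1 := fun r hr => by
    simp only [mem_ball_zero_iff, norm_mul, norm_pow, Complex.norm_real, norm_of_nonneg hr.1]
    exact (mul_le_of_le_one_left (norm_nonneg _) (pow_le_one₀ hr.1 hr.2)).trans_lt hz
  have hG : DifferentiableOn ℂ (fun w => w * F w) (ball 0 1) := differentiableOn_id.mul hF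
  -- The radial integrand has the primitive `r² F(r² z)`, which runs from `0` at `r = 0` to `F z` at
  -- `r = 1`.
  have hder : ∀ r ∈ uIcc (0 : ℝ) 1, HasDerivAt (fun r : ℝ => (r : ℂ) ^ 2 * F (r ^ 2 * z))
      (2 * (r : ℂ) * deriv (fun w => w * F w) (r ^ 2 * z)) r := fun r hr => by
    rw [uIcc_of_le zero_le_one] at hr
    have hFd := (hF.differentiableAt (isOpen_ball.mem_nhds (hmem r hr))).hasDerivAt
    have hs : HasDerivAt (fun r : ℝ => (r : ℂ) ^ 2) (2 * r) r := by
      have h : HasDerivAt (fun r : ℝ => (r : ℂ)) 1 r := Complex.ofRealCLM.hasDerivAt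
      exact (h.fun_pow 2).congr_deriv (by simp)
    have hs' : HasDerivAt (fun r : ℝ => (r : ℂ) ^ 2 * z) (2 * r * z) r := hs.mul_const z
    have hcomp : HasDerivAt (fun r : ℝ => F ((r : ℂ) ^ 2 * z))
        (deriv F (r ^ 2 * z) * (2 * r * z)) r := HasDerivAt.comp r hFd hs'
    have hGd : deriv (fun w => w * F w) (r ^ 2 * z) =
        F (r ^ 2 * z) + r ^ 2 * z * deriv F (r ^ 2 * z) := by
      simpa using ((hasDerivAt_id' ((r : ℂ) ^ 2 * z)).fun_mul hFd).deriv
    refine (hs.fun_mul hcomp).congr_deriv ?_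
    rw [hGd]; ring
  rw [intervalIntegral.integral_eq_sub_of_hasDerivAt hder]
  · simp
  · refine ContinuousOn.intervalIntegrable ?_
    rw [uIcc_of_le zero_le_one]
    refine ContinuousOn.mul (by fun_prop) ?_
    exact ((hG.analyticOnNhd isOpen_ball).deriv.continuousOn).comp (by fun_prop) hmem
end Disk

/-! ### Mean-value bounds and removal of the puncture. -/

section Disk
open Metric Set Real Filter Topology

/-- Multiplication by `a` has real determinant `|a|²`, the norm of `a` from ℂ to ℝ. -/
theorem volume_eq_smul_map_mul_left {a : ℂ} (ha : a ≠ 0) :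
    (volume : Measure ℂ) = ENNReal.ofReal (‖a‖ ^ 2) • (volume : Measure ℂ).map (a * ·) := by
  have hdet : LinearMap.det (LinearMap.mulLeft ℝ a) = ‖a‖ ^ 2 := by
    have := Algebra.norm_apply ℝ a
    rw [Algebra.norm_complex_eq] at this
    rw [← Complex.normSq_eq_norm_sq]
    exact this.symm
  have hne : (‖a‖ ^ 2) ≠ 0 := by positivity
  have := Measure.map_linearMap_addHaar_eq_smul_addHaar (volume : Measure ℂ)
    (f := LinearMap.mulLeft ℝ a) (by rw [hdet]; exact hne)
  have h2 : (volume : Measure ℂ).map (a * ·) = ENNReal.ofReal |(‖a‖ ^ 2)⁻¹| • volume := by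
    rw [← hdet]; exact this
  rw [h2, smul_smul, abs_of_nonneg (by positivity), ← ENNReal.ofReal_mul (by positivity),
    mul_inv_cancel₀ hne, ENNReal.ofReal_one, one_smul]

theorem lintegral_eq_mul_lintegral_comp_mul_left {a : ℂ} (ha : a ≠ 0) (φ : ℂ → ℝ≥0∞) :
    ∫⁻ w, φ w = ENNReal.ofReal (‖a‖ ^ 2) * ∫⁻ u, φ (a * u) := by
  conv_lhs => rw [volume_eq_smul_map_mul_left ha]
  rw [lintegral_smul_measure, smul_eq_mul]
  congr 1
  exact (Homeomorph.mulLeft₀ a ha).measurableEmbedding.lintegral_map φ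

theorem setLIntegral_ball_eq_mul_setLIntegral_unitDisk (c : ℂ) {a : ℂ} (ha : a ≠ 0)
    (φ : ℂ → ℝ≥0∞) :
    ∫⁻ w in ball c ‖a‖, φ w =
      ENNReal.ofReal (‖a‖ ^ 2) * ∫⁻ u in ball (0 : ℂ) 1, φ (c + a * u) := by
  rw [← lintegral_indicator measurableSet_ball, ← lintegral_indicator measurableSet_ball,
    ← lintegral_add_left_eq_self _ c, lintegral_eq_mul_lintegral_comp_mul_left ha]
  congr 1
  refine lintegral_congr fun u => ?_
  have : c + a * u ∈ ball c ‖a‖ ↔ u ∈ ball (0 : ℂ) 1 := by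
    simp only [mem_ball_iff_norm, add_sub_cancel_left, norm_mul, sub_zero]
    exact mul_lt_iff_lt_one_right (norm_pos_iff.2 ha)
  by_cases h : u ∈ ball (0 : ℂ) 1
  · rw [indicator_of_mem (this.2 h), indicator_of_mem h]
  · rw [indicator_of_notMem (mt this.1 h), indicator_of_notMem h]

/-- The `L²` norm on a disc bounds the value of a holomorphic function at the centre. -/
theorem enorm_sq_apply_zero_le {F : ℂ → ℂ} (hF : DifferentiableOn ℂ F (ball 0 1)) :
    ‖F 0‖ₑ ^ 2 ≤ ∫⁻ w in ball (0 : ℂ) 1, ‖F w‖ₑ ^ 2 := by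
  by_cases hfin : ∫⁻ w in ball (0 : ℂ) 1, ‖F w‖ₑ ^ 2 = ∞
  · rw [hfin]; exact le_top
  have hmeas : AEStronglyMeasurable F (volume.restrict (ball (0 : ℂ) 1)) :=
    hF.continuousOn.aestronglyMeasurable measurableSet_ball
  have : IsFiniteMeasure (volume.restrict (ball (0 : ℂ) 1)) :=
    ⟨by rw [Measure.restrict_apply_univ]; exact measure_ball_lt_top⟩
  have hL2 : MemLp F 2 (volume.restrict (ball (0 : ℂ) 1)) := by
    refine ⟨hmeas, ?_⟩
    rw [eLpNorm_lt_top_iff_lintegral_rpow_enorm_lt_top two_ne_zero ENNReal.ofNat_ne_top]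
    simpa using lt_top_iff_ne_top.2 hfin
  have hint : IntegrableOn F (ball 0 1) := hL2.integrable one_le_two
  have hrep := setIntegral_diskKernel_mul hF hint (z := 0) (by simp)
  have hle : ‖F 0‖ₑ ≤ ENNReal.ofReal π⁻¹ * ∫⁻ w in ball (0 : ℂ) 1, ‖F w‖ₑ := by
    rw [← hrep, ← lintegral_const_mul' _ _ ENNReal.ofReal_ne_top]
    refine (enorm_integral_le_lintegral_enorm _).trans (lintegral_mono fun w => ?_)
    have : ‖diskKernel 0 w‖ₑ = ENNReal.ofReal π⁻¹ := by
      rw [← ofReal_norm, norm_diskKernel]; simp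
    rw [enorm_mul, this]
  have hCS := ENNReal.lintegral_mul_le_Lp_mul_Lq (volume.restrict (ball (0 : ℂ) 1))
    Real.HolderConjugate.two_two hmeas.enorm (aemeasurable_const (b := (1 : ℝ≥0∞)))
  simp only [Pi.mul_apply, mul_one, ENNReal.one_rpow, lintegral_one,
    Measure.restrict_apply_univ, Complex.volume_ball] at hCS
  simp only [ENNReal.rpow_ofNat, ENNReal.ofReal_one, one_pow, one_mul] at hCS
  have hsq : ∀ x : ℝ≥0∞, (x ^ (1 / 2 : ℝ)) ^ 2 = x := fun x => by
    rw [← ENNReal.rpow_natCast, ← ENNReal.rpow_mul]; norm_num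
  calc ‖F 0‖ₑ ^ 2 ≤ (ENNReal.ofReal π⁻¹ * ((∫⁻ w in ball (0 : ℂ) 1, ‖F w‖ₑ ^ 2) ^ (1 / 2 : ℝ) *
        (NNReal.pi : ℝ≥0∞) ^ (1 / 2 : ℝ))) ^ 2 := by gcongr; exact hle.trans (by gcongr)
    _ = ENNReal.ofReal π⁻¹ ^ 2 * NNReal.pi * ∫⁻ w in ball (0 : ℂ) 1, ‖F w‖ₑ ^ 2 := by
        rw [mul_pow, mul_pow, hsq, hsq]; ring
    -- The constant `π⁻² · π = π⁻¹` is the sharp one; only that it is at most `1` is kept.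
    _ ≤ 1 * ∫⁻ w in ball (0 : ℂ) 1, ‖F w‖ₑ ^ 2 := by
        gcongr
        have : (NNReal.pi : ℝ≥0∞) = ENNReal.ofReal π := by
          rw [ENNReal.ofReal, ← NNReal.coe_real_pi, Real.toNNReal_coe]
        rw [this, ← ENNReal.ofReal_pow (by positivity), ← ENNReal.ofReal_mul (by positivity)]
        refine ENNReal.ofReal_le_one.2 ?_
        have := pi_pos
        rw [show π⁻¹ ^ 2 * π = π⁻¹ by field_simp]
        exact inv_le_one_of_one_le₀ (by linarith [pi_gt_three])
    _ = _ := one_mul _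

theorem enorm_sq_apply_le_lintegral_ball {F : ℂ → ℂ} {c : ℂ} {ρ : ℝ} (hρ : 0 < ρ)
    (hF : DifferentiableOn ℂ F (ball c ρ)) :
    ENNReal.ofReal (ρ ^ 2) * ‖F c‖ₑ ^ 2 ≤ ∫⁻ w in ball c ρ, ‖F w‖ₑ ^ 2 := by
  have hn : ‖(ρ : ℂ)‖ = ρ := by simp [abs_of_pos hρ]
  have hρ0 : (ρ : ℂ) ≠ 0 := by exact_mod_cast hρ.ne'
  have h := setLIntegral_ball_eq_mul_setLIntegral_unitDisk c hρ0 (fun w => ‖F w‖ₑ ^ 2)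
  rw [hn] at h
  rw [h]
  gcongr
  have hd : DifferentiableOn ℂ (fun u => F (c + ρ * u)) (ball 0 1) := by
    refine hF.comp (by fun_prop) fun u hu => ?_
    simp only [mem_ball_iff_norm, add_sub_cancel_left, norm_mul, sub_zero, hn] at hu ⊢
    nlinarith
  simpa using enorm_sq_apply_zero_le hd

/-- A square-integrable holomorphic function on the punctured disc extends to the disc. -/
theorem exists_differentiableOn_ball_of_punctured {F : ℂ → ℂ}
    (hF : DifferentiableOn ℂ F (ball 0 1 \ {0}))
    (hfin : ∫⁻ w in ball (0 : ℂ) 1, ‖F w‖ₑ ^ 2 ≠ ∞) :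
    ∃ G : ℂ → ℂ, DifferentiableOn ℂ G (ball 0 1) ∧ ∀ w ≠ 0, G w = F w := by
  refine ⟨Function.update F 0 (limUnder (nhdsWithin 0 {0}ᶜ) F),
    Complex.differentiableOn_update_limUnder_of_isLittleO
      (isOpen_ball.mem_nhds (mem_ball_self one_pos)) hF ?_,
    fun w hw => Function.update_of_ne hw _ _⟩
  -- The removable singularity criterion asks for `F - F 0 = o(1/z)`. The value `F 0` is arbitrary,
  -- but a constant is `o(1/z)`.
  have hF0 : (fun _ : ℂ => F 0) =o[nhdsWithin 0 {0}ᶜ] fun z : ℂ => (z - 0)⁻¹ := by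
    simp only [sub_zero]
    rw [Asymptotics.isLittleO_const_left]
    right
    exact tendsto_norm_cobounded_atTop.comp (Filter.tendsto_inv₀_nhdsNE_zero)
  refine Asymptotics.IsLittleO.sub ?_ hF0
  rw [Asymptotics.isLittleO_iff]
  intro ε hε
  have hμ : Filter.Tendsto (fun z : ℂ => (volume.restrict (ball (0 : ℂ) 1))
      (ball 0 (2 * ‖z‖))) (nhdsWithin 0 {0}ᶜ) (nhds 0) := by
    have h1 : Filter.Tendsto (fun z : ℂ => volume (ball (0 : ℂ) (2 * ‖z‖)))
        (nhdsWithin 0 {0}ᶜ) (nhds 0) := by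
      have : Filter.Tendsto (fun z : ℂ => ENNReal.ofReal (2 * ‖z‖) ^ 2 * NNReal.pi)
          (nhds 0) (nhds (ENNReal.ofReal (2 * ‖(0 : ℂ)‖) ^ 2 * NNReal.pi)) := by
        refine ENNReal.Tendsto.mul_const ?_ (Or.inr ENNReal.coe_ne_top)
        exact ((ENNReal.continuous_pow 2).comp
          (ENNReal.continuous_ofReal.comp (continuous_const.mul continuous_norm))).tendsto 0
      simp only [Complex.volume_ball]
      refine (this.mono_left nhdsWithin_le_nhds).trans_eq ?_
      simp
    exact tendsto_of_tendsto_of_tendsto_of_le_of_le tendsto_const_nhds h1 (fun _ => zero_le)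
      fun z => Measure.restrict_apply_le _ _
  have htail := tendsto_setLIntegral_zero hfin hμ
  -- The mean-value bound on the disc of radius `|z|/2` about `z` gives `(|z|/2)² |F z|² ≤ ε²/4`,
  -- that is `|F z| ≤ ε / |z|`.
  have hev := htail.eventually (Iio_mem_nhds (show (0 : ℝ≥0∞) < ENNReal.ofReal (ε ^ 2 / 4) by
    rw [ENNReal.ofReal_pos]; positivity))
  have hsmall : ∀ᶠ z : ℂ in nhdsWithin 0 {0}ᶜ, z ∈ ball (0 : ℂ) (1 / 2) :=
    nhdsWithin_le_nhds (isOpen_ball.mem_nhds (mem_ball_self (by norm_num)))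
  filter_upwards [hev, hsmall, self_mem_nhdsWithin] with z hz hz2 hz0
  have hzpos : 0 < ‖z‖ := norm_pos_iff.2 hz0
  have hz2 : ‖z‖ < 1 / 2 := by simpa using hz2
  have hsub : ball z (‖z‖ / 2) ⊆ ball (0 : ℂ) 1 \ {0} := fun w hw => by
    rw [mem_ball_iff_norm] at hw
    have h1 := norm_le_norm_add_norm_sub' w z
    have h2 := norm_le_norm_add_norm_sub w z
    refine ⟨by rw [mem_ball_zero_iff]; linarith, fun h0 => ?_⟩
    rw [mem_singleton_iff] at h0
    subst h0
    simp at hw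
    linarith
  have hsub2 : ball z (‖z‖ / 2) ⊆ ball (0 : ℂ) (2 * ‖z‖) := fun w hw => by
    rw [mem_ball_iff_norm] at hw
    have h1 := norm_le_norm_add_norm_sub' w z
    rw [mem_ball_zero_iff]; linarith
  have h := enorm_sq_apply_le_lintegral_ball (half_pos hzpos) (hF.mono hsub)
  have h3 : ∫⁻ w in ball z (‖z‖ / 2), ‖F w‖ₑ ^ 2 ≤
      ∫⁻ w in ball 0 (2 * ‖z‖), ‖F w‖ₑ ^ 2 ∂(volume.restrict (ball (0 : ℂ) 1)) := by
    rw [Measure.restrict_restrict measurableSet_ball]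
    exact lintegral_mono_set (subset_inter hsub2 (hsub.trans sdiff_subset))
  have h4 := (h.trans h3).trans hz.le
  rw [← ofReal_norm, ← ENNReal.ofReal_pow (norm_nonneg _), ← ENNReal.ofReal_mul (by positivity),
    ENNReal.ofReal_le_ofReal_iff (by positivity)] at h4
  rw [sub_zero, norm_inv, ← div_eq_mul_inv, le_div_iff₀ hzpos]
  refine le_of_sq_le_sq ?_ hε.le
  nlinarith

/-- The Bergman kernel of the disc reproduces square-integrable holomorphic functions on the
punctured disc. -/
theorem setIntegral_diskKernel_mul_of_punctured {F : ℂ → ℂ}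
    (hF : DifferentiableOn ℂ F (ball 0 1 \ {0}))
    (hfin : ∫⁻ w in ball (0 : ℂ) 1, ‖F w‖ₑ ^ 2 ≠ ∞) {z : ℂ} (hz : ‖z‖ < 1) (hz0 : z ≠ 0) :
    ∫ w in ball (0 : ℂ) 1, diskKernel z w * F w = F z := by
  obtain ⟨G, hG, hGF⟩ := exists_differentiableOn_ball_of_punctured hF hfin
  have hae : ∀ᵐ w ∂(volume.restrict (ball (0 : ℂ) 1)), G w = F w := by
    refine ae_restrict_of_ae ?_
    filter_upwards [compl_mem_ae_iff.2 (measure_singleton (0 : ℂ))] with w hw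
    exact hGF w hw
  have : IsFiniteMeasure (volume.restrict (ball (0 : ℂ) 1)) :=
    ⟨by rw [Measure.restrict_apply_univ]; exact measure_ball_lt_top⟩
  have hGi : IntegrableOn G (ball 0 1) := by
    refine MemLp.integrable (q := 2) one_le_two
      ⟨hG.continuousOn.aestronglyMeasurable measurableSet_ball, ?_⟩
    rw [eLpNorm_lt_top_iff_lintegral_rpow_enorm_lt_top two_ne_zero ENNReal.ofNat_ne_top]
    rw [lintegral_congr_ae (g := fun w => ‖F w‖ₑ ^ 2)]
    · exact lt_top_iff_ne_top.2 hfin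
    · filter_upwards [hae] with w hw
      simp [hw]
  rw [← hGF z hz0, ← setIntegral_diskKernel_mul hG hGi hz]
  refine integral_congr_ae ?_
  filter_upwards [hae] with w hw
  rw [hw]
end Disk

/-! ### The Forelli–Rudin estimate on the disc. -/

section ForelliRudin
open Metric Set Real

/-- The defining function `1 - |w|²` of the unit disc, with values in `[0, ∞]`. -/
noncomputable def diskDefect (w : ℂ) : ℝ≥0∞ := ENNReal.ofReal (1 - ‖w‖ ^ 2)

theorem measurable_diskDefect : Measurable diskDefect := by
  unfold diskDefect
  exact ENNReal.measurable_ofReal.comp (by fun_prop)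

theorem diskDefect_ne_zero {w : ℂ} (hw : ‖w‖ < 1) : diskDefect w ≠ 0 := by
  rw [diskDefect, ne_eq, ENNReal.ofReal_eq_zero, not_le]
  nlinarith [norm_nonneg w]

theorem diskDefect_ne_top (w : ℂ) : diskDefect w ≠ ∞ := ENNReal.ofReal_ne_top

theorem diskDefect_le_one (w : ℂ) : diskDefect w ≤ 1 := by
  rw [diskDefect, ENNReal.ofReal_le_one]
  nlinarith [sq_nonneg ‖w‖]

/-- Split at `δ`. Below it the denominator is `δ` and `x^(-s)` is integrable at `0` because `s < 1`;
above it the integrand is `x^(-s-1)`, integrable at infinity because `s > 0`. -/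
theorem setLIntegral_Ioo_rpow_div_max_le {s δ : ℝ} (hs0 : 0 < s) (hs1 : s < 1) (hδ : 0 < δ) :
    ∫⁻ x in Ioo (0 : ℝ) 1, ENNReal.ofReal (x ^ (-s) / max δ x) ≤
      ENNReal.ofReal ((1 / (1 - s) + 1 / s) * δ ^ (-s)) := by
  have h1 : ∫⁻ x in Ioc (0 : ℝ) δ, ENNReal.ofReal (x ^ (-s) / max δ x) ≤
      ENNReal.ofReal (1 / (1 - s) * δ ^ (-s)) := by
    have hint : IntegrableOn (fun x : ℝ => x ^ (-s) * δ⁻¹) (Ioc 0 δ) := by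
      have := (intervalIntegral.intervalIntegrable_rpow' (a := 0) (b := δ)
        (show -1 < -s by linarith)).mul_const δ⁻¹
      rwa [intervalIntegrable_iff_integrableOn_Ioc_of_le hδ.le] at this
    have hval : ∫ x in Ioc (0 : ℝ) δ, x ^ (-s) * δ⁻¹ = 1 / (1 - s) * δ ^ (-s) := by
      rw [← intervalIntegral.integral_of_le hδ.le, intervalIntegral.integral_mul_const,
        integral_rpow (Or.inl (by linarith)), zero_rpow (by linarith), rpow_add hδ, rpow_one]
      have : -s + 1 ≠ 0 := by linarith
      have : 1 - s ≠ 0 := by linarith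
      field_simp
      ring
    rw [← hval, ofReal_integral_eq_lintegral_ofReal hint]
    · refine setLIntegral_mono' measurableSet_Ioc fun x hx => ?_
      rw [max_eq_left hx.2, div_eq_mul_inv]
    · filter_upwards [ae_restrict_mem measurableSet_Ioc] with x hx
      have := hx.1
      positivity
  have h2 : ∫⁻ x in Ioi δ, ENNReal.ofReal (x ^ (-s) / max δ x) ≤
      ENNReal.ofReal (1 / s * δ ^ (-s)) := by
    have hval := integral_Ioi_rpow_of_lt (show -s - 1 < -1 by linarith) hδ
    have hint := integrableOn_Ioi_rpow_of_lt (show -s - 1 < -1 by linarith) hδ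
    have hval' : ∫ x in Ioi δ, x ^ (-s - 1) = 1 / s * δ ^ (-s) := by
      rw [hval, show -s - 1 + 1 = -s by ring]
      field_simp
    rw [← hval', ofReal_integral_eq_lintegral_ofReal hint]
    · refine setLIntegral_mono' measurableSet_Ioi fun x hx => ?_
      have hx' : δ < x := hx
      rw [max_eq_right hx'.le, rpow_sub_one (hδ.trans hx').ne']
    · filter_upwards [ae_restrict_mem measurableSet_Ioi] with x hx
      have : 0 < x := hδ.trans hx
      positivity
  have hsub : Ioo (0 : ℝ) 1 ⊆ Ioc 0 δ ∪ Ioi δ := fun x hx => by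
    rcases le_or_gt x δ with h | h
    · exact Or.inl ⟨hx.1, h⟩
    · exact Or.inr h
  refine (lintegral_mono_set hsub).trans ((lintegral_union_le _ _ _).trans ?_)
  rw [add_mul, ENNReal.ofReal_add]
  · exact add_le_add h1 h2
  · have : 0 < 1 - s := by linarith
    positivity
  · positivity

theorem setLIntegral_Ioo_comp_one_sub (φ : ℝ → ℝ≥0∞) :
    ∫⁻ r in Ioo (0 : ℝ) 1, φ (1 - r) = ∫⁻ x in Ioo (0 : ℝ) 1, φ x := by
  rw [← lintegral_indicator measurableSet_Ioo, ← lintegral_indicator measurableSet_Ioo,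
    ← lintegral_sub_left_eq_self _ (1 : ℝ)]
  refine lintegral_congr fun r => ?_
  have : 1 - r ∈ Ioo (0 : ℝ) 1 ↔ r ∈ Ioo (0 : ℝ) 1 := by simp [and_comm]
  by_cases h : r ∈ Ioo (0 : ℝ) 1
  · rw [indicator_of_mem (this.2 h), indicator_of_mem h, sub_sub_cancel]
  · rw [indicator_of_notMem (mt this.1 h), indicator_of_notMem h]

/-- The Forelli–Rudin estimate for the Bergman kernel of the disc. -/
theorem lintegral_diskKernel_mul_diskDefect_rpow_le {s : ℝ} (hs0 : 0 < s) (hs1 : s < 1) :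
    ∃ C : ℝ≥0, ∀ z : ℂ, ‖z‖ < 1 →
      ∫⁻ w in ball (0 : ℂ) 1, ‖diskKernel z w‖ₑ * diskDefect w ^ (-s) ≤
        C * diskDefect z ^ (-s) := by
  have hC : 0 ≤ 2 * (1 / (1 - s) + 1 / s) := by
    have : 0 < 1 - s := by linarith
    positivity
  refine ⟨Real.toNNReal (2 * (1 / (1 - s) + 1 / s)), fun z hz => ?_⟩
  have hδ : 0 < 1 - ‖z‖ ^ 2 := by nlinarith [norm_nonneg z]
  have hmeas : Measurable fun w => ‖diskKernel z w‖ₑ * diskDefect w ^ (-s) :=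
    (measurable_diskKernel_right z).enorm.mul (measurable_diskDefect.pow_const _)
  rw [setLIntegral_unitDisk_polar hmeas]
  have hr : ∀ r ∈ Ioo (0 : ℝ) 1, ENNReal.ofReal r * ∫⁻ θ in Ioo (-π) π,
      ‖diskKernel z (circleMap 0 r θ)‖ₑ * diskDefect (circleMap 0 r θ) ^ (-s) ≤
      ENNReal.ofReal 2 *
        ENNReal.ofReal ((1 - r) ^ (-s) / max (1 - ‖z‖ ^ 2) (1 - r)) := fun r hr => by
    have hd : ∀ θ, diskDefect (circleMap 0 r θ) ^ (-s) =
        ENNReal.ofReal ((1 - r ^ 2) ^ (-s)) := fun θ => by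
      have : ‖circleMap 0 r θ‖ = r := by simp [abs_of_pos hr.1]
      rw [diskDefect, this, ENNReal.ofReal_rpow_of_pos]
      nlinarith [hr.1, hr.2]
    simp_rw [hd]
    rw [lintegral_mul_const' _ _ ENNReal.ofReal_ne_top, lintegral_circle_diskKernel hz hr,
      ← ENNReal.ofReal_mul, ← ENNReal.ofReal_mul hr.1.le, ← ENNReal.ofReal_mul two_pos.le]
    · refine ENNReal.ofReal_le_ofReal ?_
      have hr0 := hr.1
      have hr1 : 0 < 1 - r := by linarith [hr.2]
      have hr2 : r ^ 2 ≤ r := by nlinarith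
      have hz1 : ‖z‖ ^ 2 ≤ 1 := by linarith
      -- This puts the exact circle integral `2 / (1 - |z|² r²)` in the form of the one-variable
      -- estimate, with `δ = 1 - |z|²` and `x = 1 - r`.
      have hm : max (1 - ‖z‖ ^ 2) (1 - r) ≤ 1 - ‖z‖ ^ 2 * r ^ 2 := by
        refine max_le ?_ ?_ <;> nlinarith [sq_nonneg ‖z‖, sq_nonneg r]
      have hm0 : 0 < max (1 - ‖z‖ ^ 2) (1 - r) := lt_max_of_lt_left hδ
      have hp : (1 - r ^ 2) ^ (-s) ≤ (1 - r) ^ (-s) :=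
        rpow_le_rpow_of_nonpos hr1 (by linarith) (by linarith)
      have hp0 : 0 ≤ (1 - r ^ 2) ^ (-s) := rpow_nonneg (by linarith) _
      calc r * (2 / (1 - ‖z‖ ^ 2 * r ^ 2) * (1 - r ^ 2) ^ (-s))
          ≤ 1 * (2 / max (1 - ‖z‖ ^ 2) (1 - r) * (1 - r) ^ (-s)) := by
            have : 0 < 1 - ‖z‖ ^ 2 * r ^ 2 := hm0.trans_le hm
            gcongr
            exact hr.2.le
        _ = _ := by ring
    · have := norm_mul_sq_lt_one hz hr
      have : 0 < 1 - ‖z‖ ^ 2 * r ^ 2 := by linarith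
      positivity
  refine (setLIntegral_mono' measurableSet_Ioo hr).trans ?_
  rw [lintegral_const_mul' _ _ ENNReal.ofReal_ne_top, setLIntegral_Ioo_comp_one_sub fun x =>
    ENNReal.ofReal (x ^ (-s) / max (1 - ‖z‖ ^ 2) x)]
  refine (mul_le_mul_right (setLIntegral_Ioo_rpow_div_max_le hs0 hs1 hδ) _).trans ?_
  rw [diskDefect, ENNReal.ofReal_rpow_of_pos hδ, ← ENNReal.ofReal_mul two_pos.le,
    ← ENNReal.ofReal.eq_1, ← ENNReal.ofReal_mul hC, mul_assoc]
end ForelliRudin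

/-! ### A two-weight Schur test. -/

section Schur
variable {X Y : Type*} [MeasurableSpace X] [MeasurableSpace Y]

/-- **Schur test** with weights. -/
theorem lintegral_rpow_lintegral_kernel_le {μ : Measure X} {ν : Measure Y} [SFinite μ] [SFinite ν]
    {p q : ℝ} (hpq : p.HolderConjugate q) {k : X → Y → ℝ≥0∞}
    (hk : Measurable fun x : X × Y => k x.1 x.2) {U : Y → ℝ≥0∞} {V : X → ℝ≥0∞} {ω : Y → ℝ≥0∞}
    {C₁ C₂ : ℝ≥0∞} (hC₂ : C₂ ≠ ∞) (hU : Measurable U) (hV : Measurable V)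
    (hU0 : ∀ᵐ y ∂ν, U y ≠ 0) (hUtop : ∀ᵐ y ∂ν, U y ≠ ∞)
    (h₁ : ∀ᵐ x ∂μ, ∫⁻ y, k x y * U y ^ q ∂ν ≤ C₁ * V x ^ q)
    (h₂ : ∀ᵐ y ∂ν, ∫⁻ x, k x y * V x ^ p ∂μ ≤ C₂ * (U y ^ p * ω y))
    {g : Y → ℝ≥0∞} (hg : AEMeasurable g ν) :
    ∫⁻ x, (∫⁻ y, k x y * g y ∂ν) ^ p ∂μ ≤ C₁ ^ (p / q) * C₂ * ∫⁻ y, g y ^ p * ω y ∂ν := by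
  wlog hgm : Measurable g generalizing g
  · have h := this hg.measurable_mk.aemeasurable hg.measurable_mk
    rw [lintegral_congr_ae (g := fun y => g y ^ p * ω y)
      (hg.ae_eq_mk.mono fun y hy => by simp only [hy])] at h
    refine le_of_eq_of_le (lintegral_congr fun x => ?_) h
    rw [lintegral_congr_ae (hg.ae_eq_mk.mono fun y hy => by rw [hy])]
  have hp := hpq.pos
  have hq := hpq.symm.pos
  have hkx : ∀ x, Measurable (k x) := fun x => hk.of_uncurry_left (f := k)
  -- Hölder for the splitting `k g = (k^(1/p) g / U) · (k^(1/q) U)`; the first test condition bounds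
  -- the second factor. Tonelli and the second condition then handle the first factor.
  have hpoint : ∀ᵐ x ∂μ, (∫⁻ y, k x y * g y ∂ν) ^ p ≤
      C₁ ^ (p / q) * ∫⁻ y, V x ^ p * k x y * (g y ^ p * (U y ^ p)⁻¹) ∂ν := by
    filter_upwards [h₁] with x hx
    have hsplit : ∫⁻ y, k x y * g y ∂ν =
        ∫⁻ y, ((fun y => k x y ^ (1 / p) * (g y * (U y)⁻¹)) * fun y => k x y ^ (1 / q) * U y) y ∂ν := by
      refine lintegral_congr_ae ?_
      filter_upwards [hU0, hUtop] with y h0 ht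
      simp only [Pi.mul_apply]
      rw [mul_mul_mul_comm, mul_assoc (g y), ENNReal.inv_mul_cancel h0 ht, mul_one,
        ← ENNReal.rpow_add_of_nonneg _ _ (by positivity) (by positivity), one_div, one_div,
        hpq.inv_add_inv_eq_one, ENNReal.rpow_one]
    have hH := ENNReal.lintegral_mul_le_Lp_mul_Lq ν hpq
      (f := fun y => k x y ^ (1 / p) * (g y * (U y)⁻¹)) (g := fun y => k x y ^ (1 / q) * U y)
      (((hkx x).pow_const _).mul (hgm.mul hU.inv)).aemeasurable
      (((hkx x).pow_const _).mul hU).aemeasurable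
    rw [← hsplit] at hH
    have e1 : ∀ y, (k x y ^ (1 / p) * (g y * (U y)⁻¹)) ^ p = k x y * (g y ^ p * (U y ^ p)⁻¹) :=
      fun y => by
        rw [ENNReal.mul_rpow_of_nonneg _ _ hp.le, ENNReal.mul_rpow_of_nonneg _ _ hp.le,
          ← ENNReal.rpow_mul, one_div_mul_cancel hp.ne', ENNReal.rpow_one, ENNReal.inv_rpow]
    have e2 : ∀ y, (k x y ^ (1 / q) * U y) ^ q = k x y * U y ^ q := fun y => by
        rw [ENNReal.mul_rpow_of_nonneg _ _ hq.le, ← ENNReal.rpow_mul, one_div_mul_cancel hq.ne',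
          ENNReal.rpow_one]
    simp only [e1, e2] at hH
    calc (∫⁻ y, k x y * g y ∂ν) ^ p
        ≤ ((∫⁻ y, k x y * (g y ^ p * (U y ^ p)⁻¹) ∂ν) ^ (1 / p) *
            (C₁ * V x ^ q) ^ (1 / q)) ^ p := by gcongr; exact hH.trans (by gcongr)
      _ = C₁ ^ (p / q) * (V x ^ p * ∫⁻ y, k x y * (g y ^ p * (U y ^ p)⁻¹) ∂ν) := by
        rw [ENNReal.mul_rpow_of_nonneg _ _ hp.le, ← ENNReal.rpow_mul, one_div_mul_cancel hp.ne',
          ENNReal.rpow_one, ← ENNReal.rpow_mul, ENNReal.mul_rpow_of_nonneg _ _ (by positivity),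
          ← ENNReal.rpow_mul, show 1 / q * p = p / q by ring,
          show q * (p / q) = p by field_simp]
        ring
      _ = _ := by
        congr 1
        rw [← lintegral_const_mul]
        · exact lintegral_congr fun y => by ring
        · exact (hkx x).mul ((hgm.pow_const _).mul (hU.pow_const _).inv)
  have hmeas : Measurable fun z : X × Y => V z.1 ^ p * k z.1 z.2 * (g z.2 ^ p * (U z.2 ^ p)⁻¹) :=
    (((hV.comp measurable_fst).pow_const _).mul hk).mul
      (((hgm.comp measurable_snd).pow_const _).mul ((hU.comp measurable_snd).pow_const _).inv)
  calc ∫⁻ x, (∫⁻ y, k x y * g y ∂ν) ^ p ∂μ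
      ≤ ∫⁻ x, C₁ ^ (p / q) * ∫⁻ y, V x ^ p * k x y * (g y ^ p * (U y ^ p)⁻¹) ∂ν ∂μ :=
        lintegral_mono_ae hpoint
    _ = C₁ ^ (p / q) * ∫⁻ y, ∫⁻ x, V x ^ p * k x y * (g y ^ p * (U y ^ p)⁻¹) ∂μ ∂ν := by
        rw [lintegral_const_mul _ hmeas.lintegral_prod_right', lintegral_lintegral_swap
          hmeas.aemeasurable]
    _ ≤ C₁ ^ (p / q) * ∫⁻ y, C₂ * (g y ^ p * ω y) ∂ν := by
        gcongr C₁ ^ (p / q) * ?_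
        refine lintegral_mono_ae ?_
        filter_upwards [h₂, hU0, hUtop] with y hy h0 ht
        have hky : Measurable fun x => V x ^ p * k x y :=
          (hV.pow_const _).mul (hk.comp measurable_prodMk_right)
        have h0' : U y ^ p ≠ 0 := by simp [ENNReal.rpow_eq_zero_iff, h0, ht]
        have ht' : U y ^ p ≠ ∞ := by simp [ENNReal.rpow_eq_top_iff, h0, ht]
        rw [lintegral_mul_const _ hky]
        calc (∫⁻ x, V x ^ p * k x y ∂μ) * (g y ^ p * (U y ^ p)⁻¹)
            ≤ (C₂ * (U y ^ p * ω y)) * (g y ^ p * (U y ^ p)⁻¹) := by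
              gcongr
              refine le_of_eq_of_le (lintegral_congr fun x => mul_comm _ _) hy
          _ = C₂ * (g y ^ p * ω y) * (U y ^ p * (U y ^ p)⁻¹) := by ring
          _ = _ := by rw [ENNReal.mul_inv_cancel h0' ht', mul_one]
    _ = _ := by rw [lintegral_const_mul' _ _ hC₂, mul_assoc]
end Schur

/-! ### Schur weights for the bidisc. -/

section Bidisk
open Metric Set Real

/-- Lebesgue measure on the unit disc. -/
noncomputable def unitDiskMeasure : Measure ℂ := volume.restrict (ball 0 1)

instance : IsFiniteMeasure unitDiskMeasure :=
  ⟨by rw [unitDiskMeasure, Measure.restrict_apply_univ]; exact measure_ball_lt_top⟩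

theorem ae_unitDiskMeasure_norm_lt_one : ∀ᵐ w ∂unitDiskMeasure, ‖w‖ < 1 := by
  filter_upwards [ae_restrict_mem (measurableSet_ball (x := (0 : ℂ)) (ε := 1))] with w hw
  simpa using hw

theorem ae_unitDiskMeasure_ne_zero : ∀ᵐ w ∂unitDiskMeasure, w ≠ 0 :=
  ae_restrict_of_ae (compl_mem_ae_iff.2 (measure_singleton (0 : ℂ)))

/-- Lebesgue measure on the bidisc. -/
noncomputable def bidiskMeasure : Measure (ℂ × ℂ) := unitDiskMeasure.prod unitDiskMeasure

instance : IsFiniteMeasure bidiskMeasure := by unfold bidiskMeasure; infer_instance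

theorem ae_bidiskMeasure_mem :
    ∀ᵐ x ∂bidiskMeasure, ‖x.1‖ < 1 ∧ ‖x.2‖ < 1 ∧ x.2 ≠ 0 := by
  have h1 := Measure.quasiMeasurePreserving_fst (μ := unitDiskMeasure) (ν := unitDiskMeasure)
    |>.ae ae_unitDiskMeasure_norm_lt_one
  have h2 := Measure.quasiMeasurePreserving_snd (μ := unitDiskMeasure) (ν := unitDiskMeasure)
    |>.ae (ae_unitDiskMeasure_norm_lt_one.and ae_unitDiskMeasure_ne_zero)
  unfold bidiskMeasure
  filter_upwards [h1, h2] with x hx hx2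
  exact ⟨hx, hx2⟩

/-- The Bergman kernel of the bidisc. -/
noncomputable def bidiskKernel (x y : ℂ × ℂ) : ℂ := diskKernel x.1 y.1 * diskKernel x.2 y.2

theorem measurable_kernel_mul_kernel {k : ℂ → ℂ → ℂ}
    (hk : Measurable fun p : ℂ × ℂ => k p.1 p.2) :
    Measurable fun p : (ℂ × ℂ) × (ℂ × ℂ) => k p.1.1 p.2.1 * k p.1.2 p.2.2 := by
  have h1 : Measurable fun p : (ℂ × ℂ) × (ℂ × ℂ) => (p.1.1, p.2.1) := by fun_prop
  have h2 : Measurable fun p : (ℂ × ℂ) × (ℂ × ℂ) => (p.1.2, p.2.2) := by fun_prop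
  exact (hk.comp h1).mul (hk.comp h2)

theorem measurable_bidiskKernel :
    Measurable fun p : (ℂ × ℂ) × (ℂ × ℂ) => bidiskKernel p.1 p.2 :=
  measurable_kernel_mul_kernel measurable_diskKernel

theorem conj_bidiskKernel (x y : ℂ × ℂ) : starRingEnd ℂ (bidiskKernel x y) = bidiskKernel y x := by
  simp [bidiskKernel, conj_diskKernel]

/-- Weights for which the Schur test applies to the Bergman kernel of the disc. -/
structure DiskSchurWeights (p q : ℝ) (U V ω : ℂ → ℝ≥0∞) : Prop where
  measurable_left : Measurable U
  measurable_right : Measurable V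
  measurable_weight : Measurable ω
  ne_zero : ∀ᵐ w ∂unitDiskMeasure, U w ≠ 0
  ne_top : ∀ᵐ w ∂unitDiskMeasure, U w ≠ ∞
  lintegral_left : ∃ C : ℝ≥0, ∀ᵐ z ∂unitDiskMeasure,
    ∫⁻ w, ‖diskKernel z w‖ₑ * U w ^ q ∂unitDiskMeasure ≤ C * V z ^ q
  lintegral_right : ∃ C : ℝ≥0, ∀ᵐ w ∂unitDiskMeasure,
    ∫⁻ z, ‖diskKernel z w‖ₑ * V z ^ p ∂unitDiskMeasure ≤ C * (U w ^ p * ω w)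

/-- For products of weights both test integrals against the bidisc kernel factor by Tonelli, so the
one-variable constants multiply. -/
theorem DiskSchurWeights.bidisk {p q : ℝ} (hpq : p.HolderConjugate q)
    {U₁ V₁ ω₁ U₂ V₂ ω₂ : ℂ → ℝ≥0∞}
    (h₁ : DiskSchurWeights p q U₁ V₁ ω₁) (h₂ : DiskSchurWeights p q U₂ V₂ ω₂) :
    ∃ C : ℝ≥0, ∀ g : ℂ × ℂ → ℝ≥0∞, AEMeasurable g bidiskMeasure →
      ∫⁻ x, (∫⁻ y, ‖bidiskKernel x y‖ₑ * g y ∂bidiskMeasure) ^ p ∂bidiskMeasure ≤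
        C * ∫⁻ y, g y ^ p * (ω₁ y.1 * ω₂ y.2) ∂bidiskMeasure := by
  obtain ⟨A₁, hA₁⟩ := h₁.lintegral_left
  obtain ⟨A₂, hA₂⟩ := h₂.lintegral_left
  obtain ⟨B₁, hB₁⟩ := h₁.lintegral_right
  obtain ⟨B₂, hB₂⟩ := h₂.lintegral_right
  have hp := hpq.pos
  have hq := hpq.symm.pos
  have q1 := Measure.quasiMeasurePreserving_fst (μ := unitDiskMeasure) (ν := unitDiskMeasure)
  have q2 := Measure.quasiMeasurePreserving_snd (μ := unitDiskMeasure) (ν := unitDiskMeasure)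
  have hkr : ∀ w, Measurable fun z => diskKernel z w := fun w =>
    measurable_diskKernel.of_uncurry_right (f := diskKernel)
  refine ⟨(A₁ * A₂) ^ (p / q) * (B₁ * B₂), fun g hg => ?_⟩
  have := lintegral_rpow_lintegral_kernel_le (μ := bidiskMeasure) (ν := bidiskMeasure) hpq
    (k := fun x y => ‖bidiskKernel x y‖ₑ) measurable_bidiskKernel.enorm
    (U := fun y => U₁ y.1 * U₂ y.2) (V := fun y => V₁ y.1 * V₂ y.2)
    (ω := fun y => ω₁ y.1 * ω₂ y.2) (C₁ := (A₁ * A₂ : ℝ≥0)) (C₂ := (B₁ * B₂ : ℝ≥0))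
    ENNReal.coe_ne_top
    ((h₁.measurable_left.comp measurable_fst).mul (h₂.measurable_left.comp measurable_snd))
    ((h₁.measurable_right.comp measurable_fst).mul (h₂.measurable_right.comp measurable_snd))
    ?_ ?_ ?_ ?_ hg
  · refine this.trans_eq ?_
    rw [ENNReal.coe_mul ((A₁ * A₂) ^ (p / q)), ENNReal.coe_rpow_of_nonneg _ (by positivity)]
  · filter_upwards [q1.ae h₁.ne_zero, q2.ae h₂.ne_zero] with y hy1 hy2
    exact mul_ne_zero hy1 hy2
  · filter_upwards [q1.ae h₁.ne_top, q2.ae h₂.ne_top] with y hy1 hy2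
    exact ENNReal.mul_ne_top hy1 hy2
  · filter_upwards [q1.ae hA₁, q2.ae hA₂] with x hx1 hx2
    have e : ∀ y : ℂ × ℂ, ‖bidiskKernel x y‖ₑ * (U₁ y.1 * U₂ y.2) ^ q =
        (‖diskKernel x.1 y.1‖ₑ * U₁ y.1 ^ q) * (‖diskKernel x.2 y.2‖ₑ * U₂ y.2 ^ q) := fun y => by
      rw [bidiskKernel, enorm_mul, ENNReal.mul_rpow_of_nonneg _ _ hq.le]; ring
    simp_rw [e]
    rw [bidiskMeasure, lintegral_prod_mul (f := fun w => ‖diskKernel x.1 w‖ₑ * U₁ w ^ q)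
      (g := fun w => ‖diskKernel x.2 w‖ₑ * U₂ w ^ q)
      ((measurable_diskKernel_right _).enorm.mul (h₁.measurable_left.pow_const _)).aemeasurable
      ((measurable_diskKernel_right _).enorm.mul (h₂.measurable_left.pow_const _)).aemeasurable]
    refine (mul_le_mul' hx1 hx2).trans_eq ?_
    rw [ENNReal.mul_rpow_of_nonneg _ _ hq.le, ENNReal.coe_mul]; ring
  · filter_upwards [q1.ae hB₁, q2.ae hB₂] with x hx1 hx2
    have e : ∀ y : ℂ × ℂ, ‖bidiskKernel y x‖ₑ * (V₁ y.1 * V₂ y.2) ^ p =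
        (‖diskKernel y.1 x.1‖ₑ * V₁ y.1 ^ p) * (‖diskKernel y.2 x.2‖ₑ * V₂ y.2 ^ p) := fun y => by
      rw [bidiskKernel, enorm_mul, ENNReal.mul_rpow_of_nonneg _ _ hp.le]; ring
    simp_rw [e]
    rw [bidiskMeasure, lintegral_prod_mul (f := fun w => ‖diskKernel w x.1‖ₑ * V₁ w ^ p)
      (g := fun w => ‖diskKernel w x.2‖ₑ * V₂ w ^ p)
      ((hkr _).enorm.mul (h₁.measurable_right.pow_const _)).aemeasurable
      ((hkr _).enorm.mul (h₂.measurable_right.pow_const _)).aemeasurable]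
    refine (mul_le_mul' hx1 hx2).trans_eq ?_
    rw [ENNReal.mul_rpow_of_nonneg _ _ hp.le, ENNReal.coe_mul]; ring

theorem enorm_diskKernel_symm (z w : ℂ) : ‖diskKernel z w‖ₑ = ‖diskKernel w z‖ₑ := by
  rw [← conj_diskKernel w z, RCLike.enorm_conj]

/-- The exponent `1/(pq)` turns the `q`-th and `p`-th powers into `δ^(-1/p)` and `δ^(-1/q)`, both in
the Forelli–Rudin range `(0, 1)`. -/
theorem diskSchurWeights_one {p q : ℝ} (hpq : p.HolderConjugate q) :
    DiskSchurWeights p q (fun w => diskDefect w ^ (-(p * q)⁻¹))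
      (fun w => diskDefect w ^ (-(p * q)⁻¹)) fun _ => 1 := by
  have hp := hpq.pos
  have hq := hpq.symm.pos
  have eq1 : ∀ w, (diskDefect w ^ (-(p * q)⁻¹)) ^ q = diskDefect w ^ (-p⁻¹) := fun w => by
    rw [← ENNReal.rpow_mul]; congr 1; field_simp
  have ep1 : ∀ w, (diskDefect w ^ (-(p * q)⁻¹)) ^ p = diskDefect w ^ (-q⁻¹) := fun w => by
    rw [← ENNReal.rpow_mul]; congr 1; field_simp
  refine ⟨measurable_diskDefect.pow_const _, measurable_diskDefect.pow_const _, measurable_const,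
    ?_, ?_, ?_, ?_⟩
  · filter_upwards [ae_unitDiskMeasure_norm_lt_one] with w hw
    simp [ENNReal.rpow_eq_zero_iff, diskDefect_ne_zero hw, diskDefect_ne_top]
  · filter_upwards [ae_unitDiskMeasure_norm_lt_one] with w hw
    simp [ENNReal.rpow_eq_top_iff, diskDefect_ne_zero hw, diskDefect_ne_top]
  · obtain ⟨C, hC⟩ := lintegral_diskKernel_mul_diskDefect_rpow_le (inv_pos.2 hp)
      (inv_lt_one_of_one_lt₀ hpq.lt)
    refine ⟨C, ?_⟩
    filter_upwards [ae_unitDiskMeasure_norm_lt_one] with z hz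
    simp_rw [eq1]
    exact hC z hz
  · obtain ⟨C, hC⟩ := lintegral_diskKernel_mul_diskDefect_rpow_le (inv_pos.2 hq)
      (inv_lt_one_of_one_lt₀ hpq.symm.lt)
    refine ⟨C, ?_⟩
    filter_upwards [ae_unitDiskMeasure_norm_lt_one] with z hz
    simp_rw [ep1, mul_one, enorm_diskKernel_symm _ z]
    exact hC z hz

theorem holderConjugate_four_thirds : (4 / 3 : ℝ).HolderConjugate 4 := by
  rw [Real.holderConjugate_iff]; norm_num

theorem one_le_diskDefect_rpow_neg {s : ℝ} (hs : 0 ≤ s) (w : ℂ) :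
    1 ≤ diskDefect w ^ (-s) := by
  rw [ENNReal.rpow_neg, ENNReal.one_le_inv]
  exact ENNReal.rpow_le_one (diskDefect_le_one w) hs

/-- The Schur weights for an integrable weight `f` that is singular only at the origin. -/
theorem diskSchurWeights_of_integrable {f : ℂ → ℝ≥0∞} (hf : Measurable f)
    (hf0 : ∀ w : ℂ, ‖w‖ < 1 → w ≠ 0 → f w ≠ 0) (hft : ∀ w : ℂ, f w ≠ ∞)
    (hf4 : ∀ w : ℂ, ‖w‖ < 1 → 1 / 2 ≤ ‖w‖ → f w ≤ 4) (hfi : ∫⁻ w, f w ∂unitDiskMeasure ≠ ∞) :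
    DiskSchurWeights (4 / 3) 4 (fun w => (diskDefect w ^ (-(3 / 4) : ℝ) + f w) ^ (1 / 4 : ℝ))
      (fun w => diskDefect w ^ (-(3 / 16) : ℝ)) fun w => f w ^ (-(1 / 3) : ℝ) := by
  have eU4 : ∀ w, ((diskDefect w ^ (-(3 / 4) : ℝ) + f w) ^ (1 / 4 : ℝ)) ^ (4 : ℝ) =
      diskDefect w ^ (-(3 / 4) : ℝ) + f w := fun w => by
    rw [← ENNReal.rpow_mul]; norm_num
  have eU43 : ∀ w, ((diskDefect w ^ (-(3 / 4) : ℝ) + f w) ^ (1 / 4 : ℝ)) ^ (4 / 3 : ℝ) =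
      (diskDefect w ^ (-(3 / 4) : ℝ) + f w) ^ (1 / 3 : ℝ) := fun w => by
    rw [← ENNReal.rpow_mul]; norm_num
  have eV4 : ∀ w, (diskDefect w ^ (-(3 / 16) : ℝ)) ^ (4 : ℝ) =
      diskDefect w ^ (-(3 / 4) : ℝ) := fun w => by
    rw [← ENNReal.rpow_mul]; norm_num
  have eV43 : ∀ w, (diskDefect w ^ (-(3 / 16) : ℝ)) ^ (4 / 3 : ℝ) =
      diskDefect w ^ (-(1 / 4) : ℝ) := fun w => by
    rw [← ENNReal.rpow_mul]; norm_num
  have hd := measurable_diskDefect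
  have hd1 : ∀ w, 1 ≤ diskDefect w ^ (-(3 / 4) : ℝ) :=
    one_le_diskDefect_rpow_neg (by norm_num)
  have hdt : ∀ w : ℂ, ‖w‖ < 1 → diskDefect w ^ (-(3 / 4) : ℝ) ≠ ∞ := fun w hw => by
    simp [ENNReal.rpow_eq_top_iff, diskDefect_ne_zero hw, diskDefect_ne_top]
  refine ⟨((hd.pow_const _).add hf).pow_const _, hd.pow_const _, hf.pow_const _, ?_, ?_, ?_, ?_⟩
  · refine Filter.Eventually.of_forall fun w h => ?_
    rw [ENNReal.rpow_eq_zero_iff_of_pos (by norm_num), add_eq_zero] at h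
    have := hd1 w
    rw [h.1] at this
    simp at this
  · filter_upwards [ae_unitDiskMeasure_norm_lt_one] with w hw
    exact ENNReal.rpow_ne_top_of_nonneg (by norm_num) (ENNReal.add_ne_top.2 ⟨hdt w hw, hft w⟩)
  · obtain ⟨C, hC⟩ := lintegral_diskKernel_mul_diskDefect_rpow_le
      (show (0 : ℝ) < 3 / 4 by norm_num) (by norm_num)
    lift (∫⁻ w, f w ∂unitDiskMeasure) to ℝ≥0 using hfi with I hI
    refine ⟨5 * C + 4 * I, ?_⟩
    filter_upwards [ae_unitDiskMeasure_norm_lt_one] with z hz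
    simp_rw [eU4, eV4]
    -- For `|w| ≥ 1/2` the bound `f ≤ 4 ≤ 4 δ^(-3/4)` absorbs `f` into the power of `δ`. For `|w| <
    -- 1/2` the kernel is at most `4`, and only the integral of `f` enters.
    have hpt : ∀ᵐ w ∂unitDiskMeasure,
        ‖diskKernel z w‖ₑ * (diskDefect w ^ (-(3 / 4) : ℝ) + f w) ≤
        5 * (‖diskKernel z w‖ₑ * diskDefect w ^ (-(3 / 4) : ℝ)) + 4 * f w := by
      filter_upwards [ae_unitDiskMeasure_norm_lt_one] with w hw
      rcases le_or_gt (1 / 2) ‖w‖ with h | h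
      · calc ‖diskKernel z w‖ₑ * (diskDefect w ^ (-(3 / 4) : ℝ) + f w)
            ≤ ‖diskKernel z w‖ₑ * (diskDefect w ^ (-(3 / 4) : ℝ) +
                4 * diskDefect w ^ (-(3 / 4) : ℝ)) := by
              gcongr
              exact (hf4 w hw h).trans (le_mul_of_one_le_right zero_le (hd1 w))
          _ = 5 * (‖diskKernel z w‖ₑ * diskDefect w ^ (-(3 / 4) : ℝ)) := by ring
          _ ≤ _ := le_self_add
      · have hk : ‖diskKernel z w‖ₑ ≤ 4 := by
          rw [enorm_diskKernel_symm, ← ofReal_norm, show (4 : ℝ≥0∞) = ENNReal.ofReal 4 by simp]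
          refine ENNReal.ofReal_le_ofReal ((norm_diskKernel_le hw hz.le).trans ?_)
          have h2 : (1 / 2 : ℝ) ≤ 1 - ‖w‖ := by linarith
          refine inv_le_of_inv_le₀ (by norm_num) ?_
          have h3 : (1 / 2 : ℝ) ^ 2 ≤ (1 - ‖w‖) ^ 2 := by gcongr
          nlinarith [pi_gt_three]
        rw [mul_add]
        refine add_le_add ?_ (by gcongr)
        exact le_mul_of_one_le_left zero_le (by norm_num)
    refine (lintegral_mono_ae hpt).trans ?_
    rw [lintegral_add_right _ (hf.const_mul _), lintegral_const_mul' _ _ (by simp),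
      lintegral_const_mul' _ _ (by simp), ← hI]
    push_cast
    rw [add_mul, mul_assoc]
    refine add_le_add (by gcongr; exact hC z hz) ?_
    exact le_mul_of_one_le_right zero_le (hd1 z)
  · obtain ⟨C, hC⟩ := lintegral_diskKernel_mul_diskDefect_rpow_le
      (show (0 : ℝ) < 1 / 4 by norm_num) (by norm_num)
    refine ⟨2 * C, ?_⟩
    filter_upwards [ae_unitDiskMeasure_norm_lt_one, ae_unitDiskMeasure_ne_zero] with w hw hw0
    simp_rw [eU43, eV43, enorm_diskKernel_symm _ w]
    refine (hC w hw).trans ?_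
    push_cast
    rw [mul_comm 2, mul_assoc]
    gcongr
    -- `(δ^(-3/4) + f)^(1/3)` dominates both `δ^(-1/4)` and `f^(1/3)`. The first is used for `|w| ≥
    -- 1/2`, where `f` is bounded; the second, which cancels `f^(-1/3)`, for `|w| < 1/2`, where
    -- `δ^(-1/4)` is bounded.
    rcases le_or_gt (1 / 2) ‖w‖ with h | h
    · calc diskDefect w ^ (-(1 / 4) : ℝ)
          ≤ diskDefect w ^ (-(1 / 4) : ℝ) * (2 * f w ^ (-(1 / 3) : ℝ)) := by
            refine le_mul_of_one_le_right zero_le ?_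
            -- The bound `4` is relaxed to `8 = 2³` to have a rational cube root.
            have h8 : f w ≤ 8 := (hf4 w hw h).trans (by norm_num)
            have : f w ^ (1 / 3 : ℝ) ≤ 2 := by
              refine (ENNReal.rpow_le_rpow h8 (by norm_num)).trans_eq ?_
              rw [show (8 : ℝ≥0∞) = 2 ^ (3 : ℝ) by norm_num, ← ENNReal.rpow_mul]
              norm_num
            rw [ENNReal.rpow_neg, ← div_eq_mul_inv, ENNReal.le_div_iff_mul_le, one_mul]
            · exact this
            · left
              rw [ne_eq, ENNReal.rpow_eq_zero_iff_of_pos (by norm_num)]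
              exact hf0 w hw hw0
            · left
              exact ENNReal.rpow_ne_top_of_nonneg (by norm_num) (hft w)
        _ = 2 * ((diskDefect w ^ (-(3 / 4) : ℝ)) ^ (1 / 3 : ℝ) * f w ^ (-(1 / 3) : ℝ)) := by
            rw [← ENNReal.rpow_mul]; norm_num; ring
        _ ≤ _ := by
            gcongr
            exact le_self_add
    · calc diskDefect w ^ (-(1 / 4) : ℝ) ≤ 2 := by
            have h1 : (1 / 16 : ℝ≥0∞) ≤ diskDefect w := by
              rw [diskDefect, show (1 / 16 : ℝ≥0∞) = ENNReal.ofReal (1 / 16) by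
                rw [ENNReal.ofReal_div_of_pos (by norm_num)]; simp]
              refine ENNReal.ofReal_le_ofReal ?_
              nlinarith [norm_nonneg w]
            rw [ENNReal.rpow_neg, ENNReal.inv_le_iff_inv_le]
            refine le_trans (le_of_eq ?_) (ENNReal.rpow_le_rpow h1 (by norm_num))
            rw [show (1 / 16 : ℝ≥0∞) = (2⁻¹) ^ (4 : ℝ) by
              rw [ENNReal.inv_rpow, one_div]; norm_num, ← ENNReal.rpow_mul]
            norm_num
        _ = 2 * (f w ^ (1 / 3 : ℝ) * f w ^ (-(1 / 3) : ℝ)) := by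
            rw [← ENNReal.rpow_add _ _ (hf0 w hw hw0) (hft w)]; norm_num
        _ ≤ _ := by
            gcongr
            exact le_add_self
end Bidisk

/-! ### Change of variables from the bidisc to the Hartogs triangle. -/

section Hartogs
open Metric Set Real

/-- The map `(u, v) ↦ (u v, v)` from the bidisc onto the Hartogs triangle. -/
def hartogsMap (x : ℂ × ℂ) : ℂ × ℂ := (x.1 * x.2, x.2)

theorem continuous_hartogsMap : Continuous hartogsMap := by unfold hartogsMap; fun_prop

theorem measurable_hartogsMap : Measurable hartogsMap := continuous_hartogsMap.measurable

theorem isOpen_hartogsTriangle : IsOpen hartogsTriangle :=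
  (isOpen_lt continuous_fst.norm continuous_snd.norm).inter
    (isOpen_lt continuous_snd.norm continuous_const)

theorem measurableSet_hartogsTriangle : MeasurableSet hartogsTriangle :=
  isOpen_hartogsTriangle.measurableSet

theorem hartogsMap_mem {x : ℂ × ℂ} (h1 : ‖x.1‖ < 1) (h2 : ‖x.2‖ < 1) (h0 : x.2 ≠ 0) :
    hartogsMap x ∈ hartogsTriangle := by
  refine ⟨?_, h2⟩
  simp only [hartogsMap, norm_mul]
  exact mul_lt_of_lt_one_left (norm_pos_iff.2 h0) h1

theorem snd_ne_zero_of_mem_hartogsTriangle {z : ℂ × ℂ} (hz : z ∈ hartogsTriangle) : z.2 ≠ 0 :=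
  norm_pos_iff.1 ((norm_nonneg _).trans_lt hz.1)

theorem norm_div_lt_one_of_mem_hartogsTriangle {z : ℂ × ℂ} (hz : z ∈ hartogsTriangle) :
    ‖z.1 / z.2‖ < 1 := by
  rw [norm_div, div_lt_one (norm_pos_iff.2 (snd_ne_zero_of_mem_hartogsTriangle hz))]
  exact hz.1

/-- The slice at height `v` is the disc of radius `|v|`; dilating it to the unit disc produces the
factor `|v|²`. -/
theorem lintegral_hartogsTriangle {φ : ℂ × ℂ → ℝ≥0∞} (hφ : Measurable φ) :
    ∫⁻ z in hartogsTriangle, φ z =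
      ∫⁻ x, ((‖x.2‖₊ ^ 2 : ℝ≥0) : ℝ≥0∞) * φ (hartogsMap x) ∂bidiskMeasure := by
  have hm : Measurable fun x : ℂ × ℂ => ((‖x.2‖₊ ^ 2 : ℝ≥0) : ℝ≥0∞) * φ (hartogsMap x) :=
    (measurable_coe_nnreal_ennreal.comp (by fun_prop)).mul (hφ.comp measurable_hartogsMap)
  rw [← lintegral_indicator measurableSet_hartogsTriangle, Measure.volume_eq_prod,
    lintegral_prod_symm _ (hφ.indicator measurableSet_hartogsTriangle).aemeasurable,
    bidiskMeasure, lintegral_prod_symm _ hm.aemeasurable]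
  conv_rhs => rw [unitDiskMeasure, ← lintegral_indicator measurableSet_ball]
  refine lintegral_congr_ae ?_
  filter_upwards [compl_mem_ae_iff.2 (measure_singleton (0 : ℂ))] with v hv
  have hv : v ≠ 0 := hv
  by_cases h : v ∈ ball (0 : ℂ) 1
  · have hsec : (fun u => hartogsTriangle.indicator φ (u, v)) =
        (ball (0 : ℂ) ‖v‖).indicator fun u => φ (u, v) := by
      have h1 : ‖v‖ < 1 := by simpa using h
      ext u
      simp [indicator, hartogsTriangle, h1]
    rw [indicator_of_mem h, hsec, lintegral_indicator measurableSet_ball,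
      setLIntegral_ball_eq_mul_setLIntegral_unitDisk 0 hv]
    rw [lintegral_const_mul' _ _ ENNReal.coe_ne_top]
    congr 1
    · rw [ENNReal.ofReal]
      congr 1
      ext
      simp
    · simp [hartogsMap, mul_comm]
  · rw [indicator_of_notMem h]
    have h1 : ¬ ‖v‖ < 1 := by simpa using h
    have hz : ∀ u, hartogsTriangle.indicator φ (u, v) = 0 := fun u =>
      indicator_of_notMem (fun hu => h1 hu.2) _
    simp [hz]

theorem measurable_density : Measurable fun x : ℂ × ℂ => (‖x.2‖₊ ^ 2 : ℝ≥0) := by fun_prop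

/-- The push-forward form extends the change of variables to a.e. measurable functions and to
Bochner integrals. -/
theorem restrict_hartogsTriangle_eq_map :
    (volume.restrict hartogsTriangle : Measure (ℂ × ℂ)) =
      (bidiskMeasure.withDensity fun x => ((‖x.2‖₊ ^ 2 : ℝ≥0) : ℝ≥0∞)).map hartogsMap := by
  ext s hs
  rw [Measure.map_apply measurable_hartogsMap hs, ← lintegral_indicator_one hs,
    lintegral_hartogsTriangle (measurable_one.indicator hs),
    withDensity_apply _ (measurable_hartogsMap hs),
    ← lintegral_indicator (measurable_hartogsMap hs)]
  refine lintegral_congr fun x => ?_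
  by_cases h : hartogsMap x ∈ s
  · rw [indicator_of_mem h, indicator_of_mem (by exact h)]; simp
  · rw [indicator_of_notMem h, indicator_of_notMem (by exact h)]; simp

/-- The density `|v|²` vanishes only on the null set `v = 0`. -/
theorem bidiskMeasure_absolutelyContinuous :
    bidiskMeasure ≪ bidiskMeasure.withDensity fun x => ((‖x.2‖₊ ^ 2 : ℝ≥0) : ℝ≥0∞) := by
  refine withDensity_absolutelyContinuous' measurable_density.coe_nnreal_ennreal.aemeasurable ?_
  filter_upwards [ae_bidiskMeasure_mem] with x hx
  simpa using hx.2.2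

theorem aestronglyMeasurable_comp_hartogsMap {f : ℂ × ℂ → ℂ}
    (hf : AEStronglyMeasurable f (volume.restrict hartogsTriangle)) :
    AEStronglyMeasurable (f ∘ hartogsMap) bidiskMeasure := by
  rw [restrict_hartogsTriangle_eq_map] at hf
  exact (hf.comp_measurable measurable_hartogsMap).mono_ac bidiskMeasure_absolutelyContinuous

theorem lintegral_hartogsTriangle₀ {φ : ℂ × ℂ → ℝ≥0∞}
    (hφ : AEMeasurable φ (volume.restrict hartogsTriangle)) :
    ∫⁻ z in hartogsTriangle, φ z =
      ∫⁻ x, ((‖x.2‖₊ ^ 2 : ℝ≥0) : ℝ≥0∞) * φ (hartogsMap x) ∂bidiskMeasure := by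
  rw [restrict_hartogsTriangle_eq_map] at hφ ⊢
  rw [lintegral_map' hφ measurable_hartogsMap.aemeasurable,
    lintegral_withDensity_eq_lintegral_mul_non_measurable _
      measurable_density.coe_nnreal_ennreal (Filter.Eventually.of_forall fun _ => ENNReal.coe_lt_top)]
  rfl

theorem integrableOn_hartogsTriangle_iff {G : ℂ × ℂ → ℂ}
    (hG : AEStronglyMeasurable G (volume.restrict hartogsTriangle)) :
    IntegrableOn G hartogsTriangle ↔
      Integrable (fun x => (‖x.2‖₊ ^ 2 : ℝ≥0) • G (hartogsMap x)) bidiskMeasure := by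
  rw [IntegrableOn, restrict_hartogsTriangle_eq_map] at *
  rw [integrable_map_measure hG measurable_hartogsMap.aemeasurable,
    integrable_withDensity_iff_integrable_smul measurable_density]
  rfl

theorem setIntegral_hartogsTriangle {G : ℂ × ℂ → ℂ}
    (hG : AEStronglyMeasurable G (volume.restrict hartogsTriangle)) :
    ∫ z in hartogsTriangle, G z =
      ∫ x, (‖x.2‖₊ ^ 2 : ℝ≥0) • G (hartogsMap x) ∂bidiskMeasure := by
  rw [restrict_hartogsTriangle_eq_map] at *
  rw [integral_map measurable_hartogsMap.aemeasurable hG,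
    integral_withDensity_eq_integral_smul measurable_density]

/-- The unitary pullback `L²(ℍ) → L²(D × D)`. -/
def hartogsPullback (f : ℂ × ℂ → ℂ) (x : ℂ × ℂ) : ℂ := x.2 * f (hartogsMap x)

theorem aestronglyMeasurable_hartogsPullback {f : ℂ × ℂ → ℂ}
    (hf : AEStronglyMeasurable f (volume.restrict hartogsTriangle)) :
    AEStronglyMeasurable (hartogsPullback f) bidiskMeasure :=
  measurable_snd.aestronglyMeasurable.mul (aestronglyMeasurable_comp_hartogsMap hf)

/-- An explicit formula for the Bergman kernel of the Hartogs triangle. -/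
noncomputable def hartogsKernel (z w : ℂ × ℂ) : ℂ :=
  (z.2 * starRingEnd ℂ w.2)⁻¹ * bidiskKernel (z.1 / z.2, z.2) (w.1 / w.2, w.2)

/-- The Bergman projection of the bidisc. -/
noncomputable def bidiskProjection (F : ℂ × ℂ → ℂ) (x : ℂ × ℂ) : ℂ :=
  ∫ y, bidiskKernel x y * F y ∂bidiskMeasure

theorem measurable_inv_mul_kernel_div {k : ℂ × ℂ → ℂ × ℂ → ℂ}
    (hk : Measurable fun p : (ℂ × ℂ) × (ℂ × ℂ) => k p.1 p.2) :
    Measurable fun p : (ℂ × ℂ) × (ℂ × ℂ) => (p.1.2 * starRingEnd ℂ p.2.2)⁻¹ *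
      k (p.1.1 / p.1.2, p.1.2) (p.2.1 / p.2.2, p.2.2) := by
  have h1 : Measurable fun p : (ℂ × ℂ) × (ℂ × ℂ) =>
      (((p.1.1 / p.1.2, p.1.2), (p.2.1 / p.2.2, p.2.2)) : (ℂ × ℂ) × (ℂ × ℂ)) := by fun_prop
  have h2 : Measurable fun p : (ℂ × ℂ) × (ℂ × ℂ) => (p.1.2 * starRingEnd ℂ p.2.2)⁻¹ :=
    ((measurable_snd.comp measurable_fst).mul
      (Complex.continuous_conj.measurable.comp (measurable_snd.comp measurable_snd))).inv
  exact h2.mul (hk.comp h1)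

theorem measurable_hartogsKernel :
    Measurable fun p : (ℂ × ℂ) × (ℂ × ℂ) => hartogsKernel p.1 p.2 :=
  measurable_inv_mul_kernel_div measurable_bidiskKernel

theorem measurable_hartogsKernel_right (z : ℂ × ℂ) : Measurable (hartogsKernel z) :=
  measurable_hartogsKernel.of_uncurry_left (f := hartogsKernel)

theorem measurable_bidiskKernel_right (x : ℂ × ℂ) : Measurable (bidiskKernel x) :=
  measurable_bidiskKernel.of_uncurry_left (f := bidiskKernel)

/-- The Jacobian is `|v|² = v v̄`: the factor `v̄` cancels the one in the kernel, and `v` is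
absorbed by the pullback. -/
theorem density_smul_hartogsKernel_mul (z : ℂ × ℂ) (f : ℂ × ℂ → ℂ) {y : ℂ × ℂ} (hy : y.2 ≠ 0) :
    (‖y.2‖₊ ^ 2 : ℝ≥0) • (hartogsKernel z (hartogsMap y) * f (hartogsMap y)) =
      z.2⁻¹ * (bidiskKernel (z.1 / z.2, z.2) y * hartogsPullback f y) := by
  have h1 : ((‖y.2‖₊ ^ 2 : ℝ≥0) : ℂ) = y.2 * starRingEnd ℂ y.2 := by
    rw [Complex.mul_conj, Complex.normSq_eq_norm_sq]; push_cast; rfl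
  have h2 : starRingEnd ℂ y.2 ≠ 0 := by simpa using hy
  rw [NNReal.smul_def, Complex.real_smul, h1]
  simp only [hartogsKernel, hartogsMap, hartogsPullback, mul_div_cancel_right₀ _ hy, mul_inv]
  field_simp

theorem integrable_bidiskKernel_mul {F : ℂ × ℂ → ℂ} (hF : Integrable F bidiskMeasure)
    {x : ℂ × ℂ} (h1 : ‖x.1‖ < 1) (h2 : ‖x.2‖ < 1) :
    Integrable (fun y => bidiskKernel x y * F y) bidiskMeasure := by
  refine Integrable.bdd_mul hF (measurable_bidiskKernel_right x).aestronglyMeasurable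
    (c := (π * (1 - ‖x.1‖) ^ 2)⁻¹ * (π * (1 - ‖x.2‖) ^ 2)⁻¹) ?_
  filter_upwards [ae_bidiskMeasure_mem] with y hy
  rw [bidiskKernel, norm_mul]
  have := norm_diskKernel_le h1 hy.1.le
  have := norm_diskKernel_le h2 hy.2.1.le
  gcongr

theorem aestronglyMeasurable_hartogsKernel_mul {f : ℂ × ℂ → ℂ}
    (hf : AEStronglyMeasurable f (volume.restrict hartogsTriangle)) (z : ℂ × ℂ) :
    AEStronglyMeasurable (fun w => hartogsKernel z w * f w) (volume.restrict hartogsTriangle) :=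
  (measurable_hartogsKernel_right z).aestronglyMeasurable.mul hf

theorem integrableOn_hartogsKernel_mul {f : ℂ × ℂ → ℂ}
    (hf : AEStronglyMeasurable f (volume.restrict hartogsTriangle))
    (hF : Integrable (hartogsPullback f) bidiskMeasure) {z : ℂ × ℂ} (hz : z ∈ hartogsTriangle) :
    IntegrableOn (fun w => hartogsKernel z w * f w) hartogsTriangle := by
  rw [integrableOn_hartogsTriangle_iff (aestronglyMeasurable_hartogsKernel_mul hf z)]
  refine ((integrable_bidiskKernel_mul hF (x := (z.1 / z.2, z.2))
    (norm_div_lt_one_of_mem_hartogsTriangle hz) hz.2).const_mul z.2⁻¹).congr ?_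
  filter_upwards [ae_bidiskMeasure_mem] with y hy
  exact (density_smul_hartogsKernel_mul z f hy.2.2).symm

theorem setIntegral_hartogsKernel_mul {f : ℂ × ℂ → ℂ}
    (hf : AEStronglyMeasurable f (volume.restrict hartogsTriangle)) (z : ℂ × ℂ) :
    ∫ w in hartogsTriangle, hartogsKernel z w * f w =
      z.2⁻¹ * bidiskProjection (hartogsPullback f) (z.1 / z.2, z.2) := by
  rw [setIntegral_hartogsTriangle (aestronglyMeasurable_hartogsKernel_mul hf z), bidiskProjection,
    ← integral_const_mul]
  refine integral_congr_ae ?_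
  filter_upwards [ae_bidiskMeasure_mem] with y hy
  exact density_smul_hartogsKernel_mul z f hy.2.2
end Hartogs

/-! ### Holomorphy and the reproducing property on the bidisc. -/

section Holomorphic
open Metric Set Real

theorem hasDerivAt_diskKernel_left {z w : ℂ} (hz : ‖z‖ < 1) (hw : ‖w‖ ≤ 1) :
    HasDerivAt (fun z => diskKernel z w)
      (2 * starRingEnd ℂ w * ((π : ℂ) * (1 - z * starRingEnd ℂ w) ^ 3)⁻¹) z := by
  have h0 := one_sub_mul_conj_ne_zero hz hw
  have hpi : (π : ℂ) ≠ 0 := by exact_mod_cast pi_ne_zero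
  have h1 : HasDerivAt (fun z : ℂ => 1 - z * starRingEnd ℂ w) (-starRingEnd ℂ w) z := by
    simpa using ((hasDerivAt_id' z).mul_const (starRingEnd ℂ w)).const_sub 1
  have h2 := ((h1.fun_pow 2).const_mul (π : ℂ)).fun_inv (mul_ne_zero hpi (pow_ne_zero 2 h0))
  refine h2.congr_deriv ?_
  field_simp
  ring

theorem norm_deriv_diskKernel_le {z w : ℂ} (hz : ‖z‖ < 1) (hw : ‖w‖ ≤ 1) :
    ‖2 * starRingEnd ℂ w * ((π : ℂ) * (1 - z * starRingEnd ℂ w) ^ 3)⁻¹‖ ≤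
      2 * (π * (1 - ‖z‖) ^ 3)⁻¹ := by
  have h := one_sub_norm_le_norm_one_sub_mul_conj z hw
  have h0 : 0 < 1 - ‖z‖ := by linarith
  have := pi_pos
  simp only [norm_mul, norm_inv, norm_pow, RCLike.norm_conj, Complex.norm_real, Complex.norm_ofNat,
    norm_of_nonneg pi_pos.le]
  calc 2 * ‖w‖ * (π * ‖1 - z * starRingEnd ℂ w‖ ^ 3)⁻¹
      ≤ 2 * 1 * (π * (1 - ‖z‖) ^ 3)⁻¹ := by gcongr
    _ = _ := by ring

theorem measurable_deriv_diskKernel (z : ℂ) : Measurable fun w : ℂ =>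
    2 * starRingEnd ℂ w * ((π : ℂ) * (1 - z * starRingEnd ℂ w) ^ 3)⁻¹ := by
  have hc : Measurable fun w : ℂ => starRingEnd ℂ w := Complex.continuous_conj.measurable
  exact (hc.const_mul 2).mul ((((hc.const_mul z).const_sub 1).pow_const 3).const_mul _).inv

/-- Differentiation under the integral: while `x` stays in a polydisc of radius `r < 1`, the kernel
and its derivatives are bounded uniformly in `y`, so a multiple of `|F|` dominates. -/
theorem differentiableOn_bidiskProjection {F : ℂ × ℂ → ℂ} (hF : Integrable F bidiskMeasure) :
    DifferentiableOn ℂ (bidiskProjection F) (ball 0 1 ×ˢ ball 0 1) := by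
  intro x₀ hx₀
  have h1 : ‖x₀.1‖ < 1 := by simpa using hx₀.1
  have h2 : ‖x₀.2‖ < 1 := by simpa using hx₀.2
  obtain ⟨r, hr, hr1⟩ := exists_between (max_lt h1 h2)
  have hs : ball (0 : ℂ) r ×ˢ ball (0 : ℂ) r ∈ nhds x₀ :=
    (isOpen_ball.prod isOpen_ball).mem_nhds
      ⟨by simpa using (le_max_left _ _).trans_lt hr, by simpa using (le_max_right _ _).trans_lt hr⟩
  have hnorm : ∀ x ∈ ball (0 : ℂ) r ×ˢ ball (0 : ℂ) r, ‖x.1‖ < r ∧ ‖x.2‖ < r := fun x hx =>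
    ⟨by simpa using hx.1, by simpa using hx.2⟩
  set dk : ℂ → ℂ → ℂ := fun z w =>
    2 * starRingEnd ℂ w * ((π : ℂ) * (1 - z * starRingEnd ℂ w) ^ 3)⁻¹ with hdk
  have hdkm : ∀ z, Measurable (dk z) := measurable_deriv_diskKernel
  have h0r : 0 < 1 - r := by linarith
  have hkb : ∀ z w : ℂ, ‖z‖ < r → ‖w‖ < 1 → ‖diskKernel z w‖ ≤ (π * (1 - r) ^ 2)⁻¹ :=
    fun z w hz hw => (norm_diskKernel_le (hz.trans hr1) hw.le).trans (by
      have := pi_pos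
      gcongr)
  have hdkb : ∀ z w : ℂ, ‖z‖ < r → ‖w‖ < 1 → ‖dk z w‖ ≤ 2 * (π * (1 - r) ^ 3)⁻¹ :=
    fun z w hz hw => (norm_deriv_diskKernel_le (hz.trans hr1) hw.le).trans (by
      have := pi_pos
      gcongr)
  set M : ℝ := (π * (1 - r) ^ 2)⁻¹ * (2 * (π * (1 - r) ^ 3)⁻¹) with hM
  have hkm : ∀ x, AEStronglyMeasurable (bidiskKernel x) bidiskMeasure := fun x =>
    (measurable_bidiskKernel_right x).aestronglyMeasurable
  set F' : ℂ × ℂ → ℂ × ℂ → (ℂ × ℂ →L[ℂ] ℂ) := fun x y =>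
    (diskKernel x.1 y.1 * dk x.2 y.2 * F y) • ContinuousLinearMap.snd ℂ ℂ ℂ +
      (dk x.1 y.1 * diskKernel x.2 y.2 * F y) • ContinuousLinearMap.fst ℂ ℂ ℂ with hF'
  have hmain : HasFDerivAt (fun x => ∫ y, bidiskKernel x y * F y ∂bidiskMeasure)
      (∫ y, F' x₀ y ∂bidiskMeasure) x₀ := by
    refine hasFDerivAt_integral_of_dominated_of_fderiv_le (bound := fun y => 2 * M * ‖F y‖) hs
      (Filter.Eventually.of_forall fun x => (hkm x).mul hF.1)
      (integrable_bidiskKernel_mul hF h1 h2) ?_ ?_ (hF.norm.const_mul _) ?_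
    · refine AEStronglyMeasurable.add (AEStronglyMeasurable.smul_const ?_ _)
        (AEStronglyMeasurable.smul_const ?_ _)
      · exact ((((measurable_diskKernel_right _).comp measurable_fst).mul
          ((hdkm _).comp measurable_snd)).aestronglyMeasurable).mul hF.1
      · exact ((((hdkm _).comp measurable_fst).mul
          ((measurable_diskKernel_right _).comp measurable_snd)).aestronglyMeasurable).mul hF.1
    · filter_upwards [ae_bidiskMeasure_mem] with y hy x hx
      obtain ⟨hx1, hx2⟩ := hnorm x hx
      have e1 : ‖(diskKernel x.1 y.1 * dk x.2 y.2 * F y) • ContinuousLinearMap.snd ℂ ℂ ℂ‖ ≤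
          M * ‖F y‖ := by
        rw [norm_smul, norm_mul, norm_mul]
        refine (mul_le_of_le_one_right (by positivity)
          (ContinuousLinearMap.norm_snd_le ℂ ℂ ℂ)).trans ?_
        have := hkb _ _ hx1 hy.1
        have := hdkb _ _ hx2 hy.2.1
        rw [hM]
        gcongr
      have e2 : ‖(dk x.1 y.1 * diskKernel x.2 y.2 * F y) • ContinuousLinearMap.fst ℂ ℂ ℂ‖ ≤
          M * ‖F y‖ := by
        rw [norm_smul, norm_mul, norm_mul]
        refine (mul_le_of_le_one_right (by positivity)
          (ContinuousLinearMap.norm_fst_le ℂ ℂ ℂ)).trans ?_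
        have := hkb _ _ hx2 hy.2.1
        have := hdkb _ _ hx1 hy.1
        rw [hM, mul_comm ‖dk x.1 y.1‖]
        gcongr
      refine (norm_add_le _ _).trans ?_
      linarith
    · filter_upwards [ae_bidiskMeasure_mem] with y hy x hx
      obtain ⟨hx1, hx2⟩ := hnorm x hx
      have d1 : HasFDerivAt (fun x : ℂ × ℂ => diskKernel x.1 y.1)
          (dk x.1 y.1 • ContinuousLinearMap.fst ℂ ℂ ℂ) x :=
        (hasDerivAt_diskKernel_left (hx1.trans hr1) hy.1.le).comp_hasFDerivAt x hasFDerivAt_fst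
      have d2 : HasFDerivAt (fun x : ℂ × ℂ => diskKernel x.2 y.2)
          (dk x.2 y.2 • ContinuousLinearMap.snd ℂ ℂ ℂ) x :=
        (hasDerivAt_diskKernel_left (hx2.trans hr1) hy.2.1.le).comp_hasFDerivAt x hasFDerivAt_snd
      refine ((d1.fun_mul d2).mul_const (F y)).congr_fderiv ?_
      simp only [hF', smul_add, smul_smul]
      congr 2 <;> ring
  exact hmain.differentiableAt.differentiableWithinAt

theorem memLp_two_iff_lintegral {α : Type*} [MeasurableSpace α] {μ : Measure α} {F : α → ℂ}
    (hF : AEStronglyMeasurable F μ) : MemLp F 2 μ ↔ ∫⁻ y, ‖F y‖ₑ ^ 2 ∂μ ≠ ∞ := by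
  rw [MemLp, eLpNorm_lt_top_iff_lintegral_rpow_enorm_lt_top two_ne_zero ENNReal.ofNat_ne_top]
  simp [hF, lt_top_iff_ne_top]

/-- The Bergman kernel of the bidisc reproduces square-integrable holomorphic functions on
`D × D*`. -/
theorem bidiskProjection_eq_self {F : ℂ × ℂ → ℂ}
    (hF : DifferentiableOn ℂ F (ball 0 1 ×ˢ (ball 0 1 \ {0})))
    (hL2 : MemLp F 2 bidiskMeasure) {x : ℂ × ℂ} (hx : x ∈ ball (0 : ℂ) 1 ×ˢ (ball (0 : ℂ) 1 \ {0})) :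
    bidiskProjection F x = F x := by
  have h1 : ‖x.1‖ < 1 := by simpa using hx.1
  have h2 : ‖x.2‖ < 1 := by simpa using hx.2.1
  have h20 : x.2 ≠ 0 := by simpa using hx.2.2
  have hint := integrable_bidiskKernel_mul (hL2.integrable one_le_two) h1 h2
  have hFint := hL2.integrable one_le_two
  have hfin := (memLp_two_iff_lintegral hL2.1).1 hL2
  rw [bidiskProjection]
  unfold bidiskMeasure at hint hFint hfin ⊢
  have hdiff1 : ∀ v ∈ ball (0 : ℂ) 1 \ {0},
      DifferentiableOn ℂ (fun u => F (u, v)) (ball 0 1) := fun v hv =>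
    hF.comp (by fun_prop) fun u hu => ⟨hu, hv⟩
  have hdiff2 : DifferentiableOn ℂ (fun v => F (x.1, v)) (ball 0 1 \ {0}) :=
    hF.comp (by fun_prop) fun v hv => ⟨hx.1, hv⟩
  -- The variable `u` is integrated first, since `F(·, v)` is holomorphic on the whole disc for each
  -- `v ≠ 0`; the puncture is met only in the remaining variable.
  rw [integral_prod_symm _ hint]
  have hinner : ∀ᵐ v ∂unitDiskMeasure,
      ∫ u, bidiskKernel x (u, v) * F (u, v) ∂unitDiskMeasure = diskKernel x.2 v * F (x.1, v) := by
    filter_upwards [hFint.prod_left_ae, ae_unitDiskMeasure_norm_lt_one,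
      ae_unitDiskMeasure_ne_zero] with v hv hv1 hv0
    have := setIntegral_diskKernel_mul (hdiff1 v ⟨by simpa using hv1, hv0⟩) hv h1
    rw [← this, ← integral_const_mul]
    refine integral_congr_ae (Filter.Eventually.of_forall fun u => ?_)
    simp only [bidiskKernel]
    ring
  rw [integral_congr_ae hinner]
  refine setIntegral_diskKernel_mul_of_punctured hdiff2 ?_ h2 h20
  -- The slice at the given `x.1` must be in L², not merely almost every slice. The mean-value bound
  -- in `u` on the disc of radius `1 - |x.1|` about `x.1` provides this.
  have hρ : 0 < 1 - ‖x.1‖ := by linarith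
  have hsub : ball x.1 (1 - ‖x.1‖) ⊆ ball (0 : ℂ) 1 := ball_subset_ball' (by simp)
  have hle : ∀ᵐ v ∂unitDiskMeasure, ENNReal.ofReal ((1 - ‖x.1‖) ^ 2) * ‖F (x.1, v)‖ₑ ^ 2 ≤
      ∫⁻ u, ‖F (u, v)‖ₑ ^ 2 ∂unitDiskMeasure := by
    filter_upwards [ae_unitDiskMeasure_norm_lt_one, ae_unitDiskMeasure_ne_zero] with v hv1 hv0
    have hd := hdiff1 v ⟨by simpa using hv1, hv0⟩
    exact (enorm_sq_apply_le_lintegral_ball hρ (hd.mono hsub)).trans (lintegral_mono_set hsub)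
  have hmul : ENNReal.ofReal ((1 - ‖x.1‖) ^ 2) *
      ∫⁻ v, ‖F (x.1, v)‖ₑ ^ 2 ∂unitDiskMeasure ≠ ∞ := by
    rw [← lintegral_const_mul' _ _ ENNReal.ofReal_ne_top]
    refine ne_top_of_le_ne_top ?_ (lintegral_mono_ae hle)
    rwa [← lintegral_prod_symm _ (hL2.1.enorm.pow_const 2)]
  intro htop
  rw [unitDiskMeasure, htop, ENNReal.mul_top] at hmul
  · exact hmul rfl
  · rw [ne_eq, ENNReal.ofReal_eq_zero, not_le]; positivity
end Holomorphic

/-! ### The explicit kernel represents the orthogonal projection. -/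

section BergmanKernel
open Metric Set Real

/-- Self-adjointness, from the Hermitian symmetry of the kernel. Fubini is justified because the
operator with kernel `|K|` is already bounded on L², by the Schur test with `p = q = 2`. -/
theorem integral_mul_conj_bidiskProjection_swap {F G : ℂ × ℂ → ℂ} (hF : MemLp F 2 bidiskMeasure)
    (hG : MemLp G 2 bidiskMeasure) :
    ∫ x, bidiskProjection F x * starRingEnd ℂ (G x) ∂bidiskMeasure =
      ∫ y, F y * starRingEnd ℂ (bidiskProjection G y) ∂bidiskMeasure := by
  have hconj : Measurable fun z : ℂ => starRingEnd ℂ z := Complex.continuous_conj.measurable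
  have hmeas : AEStronglyMeasurable
      (fun p : (ℂ × ℂ) × (ℂ × ℂ) => bidiskKernel p.1 p.2 * F p.2 * starRingEnd ℂ (G p.1))
      (bidiskMeasure.prod bidiskMeasure) :=
    (measurable_bidiskKernel.aestronglyMeasurable.mul hF.1.comp_snd).mul
      (Complex.continuous_conj.comp_aestronglyMeasurable hG.1.comp_fst)
  have hint : Integrable
      (fun p : (ℂ × ℂ) × (ℂ × ℂ) => bidiskKernel p.1 p.2 * F p.2 * starRingEnd ℂ (G p.1))
      (bidiskMeasure.prod bidiskMeasure) := by
    refine ⟨hmeas, ?_⟩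
    rw [HasFiniteIntegral, lintegral_prod _ hmeas.enorm]
    obtain ⟨C, hC⟩ := (diskSchurWeights_one Real.HolderConjugate.two_two).bidisk
      Real.HolderConjugate.two_two (diskSchurWeights_one Real.HolderConjugate.two_two)
    have hT := hC (fun y => ‖F y‖ₑ) hF.1.enorm
    have hin : ∀ x, ∫⁻ y, ‖bidiskKernel x y * F y * starRingEnd ℂ (G x)‖ₑ ∂bidiskMeasure =
        (∫⁻ y, ‖bidiskKernel x y‖ₑ * ‖F y‖ₑ ∂bidiskMeasure) * ‖G x‖ₑ := fun x => by
      rw [← lintegral_mul_const' _ _ enorm_ne_top]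
      simp only [enorm_mul, RCLike.enorm_conj]
    simp only [hin]
    have hTm : AEMeasurable (fun x => ∫⁻ y, ‖bidiskKernel x y‖ₑ * ‖F y‖ₑ ∂bidiskMeasure)
        bidiskMeasure :=
      (measurable_bidiskKernel.enorm.aemeasurable.mul
        hF.1.enorm.comp_snd).lintegral_prod_right'
    refine (ENNReal.lintegral_mul_le_Lp_mul_Lq bidiskMeasure Real.HolderConjugate.two_two hTm
      hG.1.enorm).trans_lt ?_
    have hF2 := (memLp_two_iff_lintegral hF.1).1 hF
    have hG2 := (memLp_two_iff_lintegral hG.1).1 hG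
    refine ENNReal.mul_lt_top ?_ ?_
    · refine ENNReal.rpow_lt_top_of_nonneg (by norm_num) (ne_top_of_le_ne_top ?_ hT)
      refine ENNReal.mul_ne_top ENNReal.coe_ne_top ?_
      simpa using hF2
    · refine ENNReal.rpow_lt_top_of_nonneg (by norm_num) ?_
      simpa using hG2
  calc ∫ x, bidiskProjection F x * starRingEnd ℂ (G x) ∂bidiskMeasure
      = ∫ x, ∫ y, bidiskKernel x y * F y * starRingEnd ℂ (G x) ∂bidiskMeasure ∂bidiskMeasure := by
        simp only [bidiskProjection, integral_mul_const]
    _ = ∫ y, ∫ x, bidiskKernel x y * F y * starRingEnd ℂ (G x) ∂bidiskMeasure ∂bidiskMeasure :=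
        integral_integral_swap hint
    _ = _ := by
        refine integral_congr_ae (Filter.Eventually.of_forall fun y => ?_)
        simp only [bidiskProjection]
        rw [← integral_conj, ← integral_const_mul]
        refine integral_congr_ae (Filter.Eventually.of_forall fun x => ?_)
        simp only [map_mul, conj_bidiskKernel]
        ring

theorem enorm_bidiskProjection_le (F : ℂ × ℂ → ℂ) (x : ℂ × ℂ) :
    ‖bidiskProjection F x‖ₑ ≤ ∫⁻ y, ‖bidiskKernel x y‖ₑ * ‖F y‖ₑ ∂bidiskMeasure := by
  refine (enorm_integral_le_lintegral_enorm _).trans_eq ?_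
  simp only [enorm_mul]

theorem aestronglyMeasurable_bidiskProjection {F : ℂ × ℂ → ℂ}
    (hF : AEStronglyMeasurable F bidiskMeasure) :
    AEStronglyMeasurable (bidiskProjection F) bidiskMeasure :=
  AEStronglyMeasurable.integral_prod_right'
    (f := fun p : (ℂ × ℂ) × (ℂ × ℂ) => bidiskKernel p.1 p.2 * F p.2)
    (measurable_bidiskKernel.aestronglyMeasurable.mul hF.comp_snd)

theorem memLp_bidiskProjection {F : ℂ × ℂ → ℂ} (hF : MemLp F 2 bidiskMeasure) :
    MemLp (bidiskProjection F) 2 bidiskMeasure := by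
  rw [memLp_two_iff_lintegral (aestronglyMeasurable_bidiskProjection hF.1)]
  obtain ⟨C, hC⟩ := (diskSchurWeights_one Real.HolderConjugate.two_two).bidisk
    Real.HolderConjugate.two_two (diskSchurWeights_one Real.HolderConjugate.two_two)
  have hT := hC (fun y => ‖F y‖ₑ) hF.1.enorm
  have hF2 := (memLp_two_iff_lintegral hF.1).1 hF
  refine ne_top_of_le_ne_top (ENNReal.mul_ne_top ENNReal.coe_ne_top ?_)
    ((lintegral_mono fun x => ?_).trans hT)
  · simpa using hF2
  · simp only [ENNReal.rpow_ofNat]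
    gcongr
    exact enorm_bidiskProjection_le F x

theorem enorm_hartogsPullback_sq (f : ℂ × ℂ → ℂ) (x : ℂ × ℂ) :
    ‖hartogsPullback f x‖ₑ ^ 2 = ((‖x.2‖₊ ^ 2 : ℝ≥0) : ℝ≥0∞) * ‖f (hartogsMap x)‖ₑ ^ 2 := by
  rw [hartogsPullback, enorm_mul, mul_pow, enorm_eq_nnnorm x.2, ENNReal.coe_pow]

theorem memLp_hartogsPullback_iff {f : ℂ × ℂ → ℂ}
    (hf : AEStronglyMeasurable f (volume.restrict hartogsTriangle)) :
    MemLp (hartogsPullback f) 2 bidiskMeasure ↔ MemLp f 2 (volume.restrict hartogsTriangle) := by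
  rw [memLp_two_iff_lintegral hf, memLp_two_iff_lintegral (aestronglyMeasurable_hartogsPullback hf),
    lintegral_hartogsTriangle₀ (hf.enorm.pow_const 2)]
  simp only [enorm_hartogsPullback_sq]

theorem mapsTo_div_hartogsTriangle :
    MapsTo (fun z : ℂ × ℂ => (z.1 / z.2, z.2)) hartogsTriangle (ball 0 1 ×ˢ ball 0 1) :=
  fun z hz => ⟨by simpa using norm_div_lt_one_of_mem_hartogsTriangle hz, by simpa using hz.2⟩

theorem hartogsPullback_inv_mul {g F : ℂ × ℂ → ℂ}
    (hg : ∀ z ∈ hartogsTriangle, g z = z.2⁻¹ * F (z.1 / z.2, z.2)) :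
    hartogsPullback g =ᵐ[bidiskMeasure] F := by
  filter_upwards [ae_bidiskMeasure_mem] with x hx
  rw [hartogsPullback, hg _ (hartogsMap_mem hx.1 hx.2.1 hx.2.2)]
  simp [hartogsMap, hx.2.2]

theorem differentiableOn_hartogsPullback {h : ℂ × ℂ → ℂ}
    (hh : DifferentiableOn ℂ h hartogsTriangle) :
    DifferentiableOn ℂ (hartogsPullback h) (ball 0 1 ×ˢ (ball 0 1 \ {0})) := by
  refine DifferentiableOn.mul (by fun_prop) (hh.comp ?_ fun x hx => ?_)
  · unfold hartogsMap; fun_prop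
  · exact hartogsMap_mem (by simpa using hx.1) (by simpa using hx.2.1) (by simpa using hx.2.2)

theorem differentiableOn_inv_mul_bidiskProjection {F : ℂ × ℂ → ℂ}
    (hF : Integrable F bidiskMeasure) :
    DifferentiableOn ℂ (fun z => z.2⁻¹ * bidiskProjection F (z.1 / z.2, z.2)) hartogsTriangle := by
  have hne : ∀ z ∈ hartogsTriangle, z.2 ≠ 0 := fun z hz => snd_ne_zero_of_mem_hartogsTriangle hz
  have hsnd : DifferentiableOn ℂ (fun z : ℂ × ℂ => z.2) hartogsTriangle := by fun_prop
  refine (hsnd.fun_inv hne).mul ((differentiableOn_bidiskProjection hF).comp ?_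
    mapsTo_div_hartogsTriangle)
  simp only [div_eq_mul_inv]
  exact (differentiableOn_fst.mul (hsnd.fun_inv hne)).prodMk hsnd

/-- After pullback, `⟨PF, H⟩ = ⟨F, PH⟩ = ⟨F, H⟩` for `H` pulled back from the Bergman space:
self-adjointness followed by the reproducing property. This is the required orthogonality. -/
theorem isBergmanKernel_hartogsKernel : IsBergmanKernel hartogsTriangle hartogsKernel := by
  intro f hf
  have hF2 : MemLp (hartogsPullback f) 2 bidiskMeasure := (memLp_hartogsPullback_iff hf.1).2 hf
  have hFint := hF2.integrable one_le_two
  set g : ℂ × ℂ → ℂ := fun z => ∫ w in hartogsTriangle, hartogsKernel z w * f w with hgdef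
  have hg : ∀ z ∈ hartogsTriangle,
      g z = z.2⁻¹ * bidiskProjection (hartogsPullback f) (z.1 / z.2, z.2) := fun z _ =>
    setIntegral_hartogsKernel_mul hf.1 z
  have hgd : DifferentiableOn ℂ g hartogsTriangle :=
    (differentiableOn_inv_mul_bidiskProjection hFint).congr hg
  have hgm : AEStronglyMeasurable g (volume.restrict hartogsTriangle) :=
    hgd.continuousOn.aestronglyMeasurable measurableSet_hartogsTriangle
  have hpull := hartogsPullback_inv_mul hg
  have hg2 : MemLp g 2 (volume.restrict hartogsTriangle) :=
    (memLp_hartogsPullback_iff hgm).1 ((memLp_bidiskProjection hF2).ae_eq hpull.symm)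
  refine ⟨fun z hz => integrableOn_hartogsKernel_mul hf.1 hFint hz, ⟨hgd, hg2⟩, fun h hh => ?_⟩
  have hH2 := (memLp_hartogsPullback_iff hh.2.1).2 hh.2
  have hHself : bidiskProjection (hartogsPullback h) =ᵐ[bidiskMeasure] hartogsPullback h := by
    filter_upwards [ae_bidiskMeasure_mem] with x hx
    exact bidiskProjection_eq_self (differentiableOn_hartogsPullback hh.1) hH2
      ⟨by simpa using hx.1, by simpa using hx.2.1, by simpa using hx.2.2⟩
  have hconjm : AEStronglyMeasurable (fun w => starRingEnd ℂ (h w))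
      (volume.restrict hartogsTriangle) :=
    Complex.continuous_conj.comp_aestronglyMeasurable hh.2.1
  have hconjL : MemLp (fun x => starRingEnd ℂ (hartogsPullback h x)) 2 bidiskMeasure :=
    hH2.star
  rw [setIntegral_hartogsTriangle (G := fun w => (f w - g w) * starRingEnd ℂ (h w))
    ((hf.1.sub hgm).mul hconjm)]
  have e : ∀ᵐ x ∂bidiskMeasure, (‖x.2‖₊ ^ 2 : ℝ≥0) •
      ((f (hartogsMap x) - g (hartogsMap x)) * starRingEnd ℂ (h (hartogsMap x))) =
      hartogsPullback f x * starRingEnd ℂ (hartogsPullback h x) -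
        bidiskProjection (hartogsPullback f) x * starRingEnd ℂ (hartogsPullback h x) := by
    filter_upwards [hpull] with x hx
    rw [← hx]
    have h1 : ((‖x.2‖₊ ^ 2 : ℝ≥0) : ℂ) = x.2 * starRingEnd ℂ x.2 := by
      rw [Complex.mul_conj, Complex.normSq_eq_norm_sq]; push_cast; rfl
    rw [NNReal.smul_def, Complex.real_smul, h1]
    simp only [hartogsPullback, map_mul]
    ring
  have i₁ : Integrable (fun x => hartogsPullback f x * starRingEnd ℂ (hartogsPullback h x))
      bidiskMeasure := hF2.integrable_mul hconjL
  have i₂ : Integrable (fun x => bidiskProjection (hartogsPullback f) x *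
      starRingEnd ℂ (hartogsPullback h x)) bidiskMeasure :=
    (memLp_bidiskProjection hF2).integrable_mul hconjL
  rw [integral_congr_ae e, integral_sub i₁ i₂,
    integral_mul_conj_bidiskProjection_swap hF2 hH2, sub_eq_zero]
  refine integral_congr_ae ?_
  filter_upwards [hHself] with x hx
  rw [hx]
end BergmanKernel

/-! ### Uniqueness of the Bergman projection and kernel. -/

section Uniqueness
open Metric Set

/-- The difference `g₁ - g₂` lies in the Bergman space and is orthogonal to itself, so it vanishes
a.e., and everywhere on the open set by continuity. -/
theorem IsBergmanProjectionOf.eqOn {Ω : Set (ℂ × ℂ)} (hΩ : IsOpen Ω) {f g₁ g₂ : ℂ × ℂ → ℂ}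
    (hf : MemLp f 2 (volume.restrict Ω)) (h₁ : IsBergmanProjectionOf Ω f g₁)
    (h₂ : IsBergmanProjectionOf Ω f g₂) : EqOn g₁ g₂ Ω := by
  have hd : g₁ - g₂ ∈ bergmanSpace Ω := ⟨h₁.1.1.sub h₂.1.1, h₁.1.2.sub h₂.1.2⟩
  have hconj : MemLp (fun w => starRingEnd ℂ ((g₁ - g₂) w)) 2 (volume.restrict Ω) := hd.2.star
  have e1 := h₁.2 _ hd
  have e2 := h₂.2 _ hd
  have hsub := integral_sub ((hf.sub h₂.1.2).integrable_mul hconj)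
    ((hf.sub h₁.1.2).integrable_mul hconj)
  simp only [Pi.mul_apply] at hsub
  have hzero : ∫ w in Ω, ((‖(g₁ - g₂) w‖ ^ 2 : ℝ) : ℂ) = 0 := by
    calc ∫ w in Ω, ((‖(g₁ - g₂) w‖ ^ 2 : ℝ) : ℂ)
        = ∫ w in Ω, ((f - g₂) w * starRingEnd ℂ ((g₁ - g₂) w) -
            (f - g₁) w * starRingEnd ℂ ((g₁ - g₂) w)) := by
          refine integral_congr_ae (Filter.Eventually.of_forall fun w => ?_)
          simp only
          rw [← sub_mul, show (f - g₂) w - (f - g₁) w = (g₁ - g₂) w by simp, Complex.mul_conj,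
            Complex.normSq_eq_norm_sq]
      _ = 0 := by
          rw [hsub]
          simp only [Pi.sub_apply] at e1 e2 ⊢
          rw [e1, e2, sub_zero]
  rw [integral_complex_ofReal] at hzero
  have hzero' : ∫ w in Ω, ‖(g₁ - g₂) w‖ ^ 2 = 0 := by exact_mod_cast hzero
  rw [integral_eq_zero_iff_of_nonneg (fun w => by positivity)] at hzero'
  · refine Measure.eqOn_open_of_ae_eq (μ := volume) ?_ hΩ h₁.1.1.continuousOn h₂.1.1.continuousOn
    filter_upwards [hzero'] with w hw
    simpa [sub_eq_zero] using hw
  · exact hd.2.integrable_norm_pow two_ne_zero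

/-- For a bounded open set the Bergman kernel is unique almost everywhere. -/
theorem IsBergmanKernel.ae_eq {Ω : Set (ℂ × ℂ)} (hΩ : IsOpen Ω) (hfin : volume Ω ≠ ∞)
    {K₁ K₂ : ℂ × ℂ → ℂ × ℂ → ℂ} (h₁ : IsBergmanKernel Ω K₁) (h₂ : IsBergmanKernel Ω K₂)
    {z : ℂ × ℂ} (hz : z ∈ Ω) : K₁ z =ᵐ[volume.restrict Ω] K₂ z := by
  have : IsFiniteMeasure (volume.restrict Ω) :=
    ⟨by rw [Measure.restrict_apply_univ]; exact lt_top_iff_ne_top.2 hfin⟩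
  have hone : MemLp (fun _ : ℂ × ℂ => (1 : ℂ)) 2 (volume.restrict Ω) := memLp_const _
  have i₁ := (h₁ _ hone).1 z hz
  have i₂ := (h₂ _ hone).1 z hz
  simp only [mul_one] at i₁ i₂
  -- Indicators of measurable sets are admissible inputs, so pointwise equality of their projections
  -- says that the two kernels have equal integrals over every such set.
  refine Integrable.ae_eq_of_forall_setIntegral_eq _ _ i₁ i₂ fun s hs _ => ?_
  have hind : MemLp (s.indicator fun _ : ℂ × ℂ => (1 : ℂ)) 2 (volume.restrict Ω) :=
    hone.indicator hs
  have h := (h₁ _ hind).2.eqOn hΩ hind (h₂ _ hind).2 hz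
  have e : ∀ K : ℂ × ℂ → ℂ × ℂ → ℂ,
      (fun w => K z w * s.indicator (fun _ => (1 : ℂ)) w) = s.indicator (K z) := fun K => by
    ext w; by_cases hw : w ∈ s <;> simp [hw]
  simp only [e, integral_indicator hs] at h
  exact h
end Uniqueness

/-! ### Identification of the Bergman kernel of the Hartogs triangle. -/

section HartogsBergman
open Metric Set

theorem volume_hartogsTriangle_ne_top : volume hartogsTriangle ≠ ∞ := by
  refine ((isBounded_ball (x := (0 : ℂ × ℂ)) (r := 1)).subset fun z hz => ?_).measure_lt_top.ne
  rw [mem_ball_zero_iff, Prod.norm_def, max_lt_iff]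
  exact ⟨hz.1.trans hz.2, hz.2⟩

theorem isBergmanKernel_bergmanKernel :
    IsBergmanKernel hartogsTriangle (bergmanKernel hartogsTriangle) :=
  Classical.epsilon_spec (p := fun K => IsBergmanKernel hartogsTriangle K)
    ⟨hartogsKernel, isBergmanKernel_hartogsKernel⟩

/-- The kernel chosen by `Classical.epsilon` is known only up to null sets in `w`; this suffices to
replace it by the explicit one under every integral. -/
theorem bergmanKernel_mul_ae_eq {z : ℂ × ℂ} (hz : z ∈ hartogsTriangle) (f : ℂ × ℂ → ℂ) :
    (fun w => bergmanKernel hartogsTriangle z w * f w) =ᵐ[volume.restrict hartogsTriangle]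
      fun w => hartogsKernel z w * f w := by
  filter_upwards [isBergmanKernel_bergmanKernel.ae_eq isOpen_hartogsTriangle
    volume_hartogsTriangle_ne_top isBergmanKernel_hartogsKernel hz] with w hw
  rw [hw]
end HartogsBergman

/-! ### Iterated logarithms and integrability of the weight. -/

section LogWeight
open Metric Set Real

theorem one_le_iterLog {z : ℂ} (hz : ‖z‖ ≤ 1) : ∀ j, 1 ≤ iterLog j z
  | 0 => le_rfl
  | 1 => by
    have := log_nonpos (norm_nonneg z) hz
    simp only [iterLog]; linarith
  | j + 2 => by
    have h := one_le_iterLog hz (j + 1)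
    have := log_nonneg (show 1 ≤ iterLog (j + 1) z + 1 by linarith)
    simp only [iterLog]; linarith

theorem measurable_iterLog : ∀ j, Measurable (iterLog j)
  | 0 => measurable_const
  | 1 => by
    simp only [iterLog]
    exact (measurable_log.comp measurable_norm).neg.add_const 1
  | j + 2 => by
    simp only [iterLog]
    exact (measurable_log.comp ((measurable_iterLog (j + 1)).add_const 1)).add_const 1

theorem iterLog_congr_norm {z w : ℂ} (h : ‖z‖ = ‖w‖) : ∀ j, iterLog j z = iterLog j w
  | 0 => rfl
  | 1 => by simp only [iterLog, h]
  | j + 2 => by simp only [iterLog, iterLog_congr_norm h (j + 1)]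

theorem logWeight_congr_norm {z w : ℂ} (h : ‖z‖ = ‖w‖) (α : ℝ) (j : ℕ) :
    logWeight α j z = logWeight α j w := by
  simp only [logWeight, h, iterLog_congr_norm h]

theorem measurable_logWeight (α : ℝ) (j : ℕ) : Measurable (logWeight α j) := by
  unfold logWeight
  refine Measurable.mul ?_ (Finset.measurable_fun_prod _ fun k _ => (measurable_iterLog k).inv)
  exact ((measurable_norm.pow_const 2).inv).mul ((measurable_iterLog j).pow_const α)

theorem logWeight_pos {z : ℂ} (hz : ‖z‖ < 1) (h0 : z ≠ 0) (α : ℝ) (j : ℕ) :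
    0 < logWeight α j z := by
  have h : ∀ k, 0 < iterLog k z := fun k => one_pos.trans_le (one_le_iterLog hz.le k)
  have := norm_pos_iff.2 h0
  refine mul_pos (mul_pos (by positivity) (rpow_pos_of_pos (h j) _))
    (Finset.prod_pos fun k _ => inv_pos.2 (h k))

theorem logWeight_le_four {z : ℂ} (hz : ‖z‖ < 1) (h2 : 1 / 2 ≤ ‖z‖) {α : ℝ} (hα : α ≤ 0) (j : ℕ) :
    logWeight α j z ≤ 4 := by
  have h : ∀ k, 1 ≤ iterLog k z := one_le_iterLog hz.le
  have e1 : (‖z‖ ^ 2)⁻¹ ≤ 4 := by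
    refine inv_le_of_inv_le₀ (by norm_num) ?_
    nlinarith
  have e2 : iterLog j z ^ α ≤ 1 := rpow_le_one_of_one_le_of_nonpos (h j) hα
  have e3 : ∏ k ∈ Finset.Ico 1 j, (iterLog k z)⁻¹ ≤ 1 :=
    Finset.prod_le_one (fun k _ => inv_nonneg.2 (zero_le_one.trans (h k)))
      fun k _ => inv_le_one_of_one_le₀ (h k)
  have e30 : 0 ≤ ∏ k ∈ Finset.Ico 1 j, (iterLog k z)⁻¹ :=
    Finset.prod_nonneg fun k _ => inv_nonneg.2 (zero_le_one.trans (h k))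
  calc logWeight α j z ≤ 4 * 1 * 1 := by
        unfold logWeight
        gcongr
        exact rpow_nonneg (zero_le_one.trans (h j)) _
    _ = 4 := by norm_num

/-- Each application of `log (· + 1)` contributes a chain-rule factor `(h_k + 1)⁻¹`, rather than the
`h_k⁻¹` of the weight. -/
theorem hasDerivAt_iterLog {r : ℝ} (h0 : 0 < r) (h1 : r ≤ 1) : ∀ j, 1 ≤ j →
    HasDerivAt (fun r : ℝ => iterLog j (r : ℂ))
      (-(r⁻¹ * ∏ k ∈ Finset.Ico 1 j, (iterLog k (r : ℂ) + 1)⁻¹)) r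
  | 0 => fun h => absurd h (by norm_num)
  | 1 => fun _ => by
    have : (fun r : ℝ => iterLog 1 (r : ℂ)) = fun r => -Real.log r + 1 := by
      ext r; simp [iterLog]
    rw [this]
    simpa using (hasDerivAt_log h0.ne').neg.add_const 1
  | j + 2 => fun _ => by
    have ih := hasDerivAt_iterLog h0 h1 (j + 1) (by omega)
    have hz : ‖(r : ℂ)‖ ≤ 1 := by simpa [abs_of_pos h0] using h1
    have hpos : iterLog (j + 1) (r : ℂ) + 1 ≠ 0 := by
      linarith [one_le_iterLog hz (j + 1)]
    simp only [iterLog]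
    refine (((ih.add_const 1).log hpos).add_const 1).congr_deriv ?_
    rw [Finset.prod_Ico_succ_top (show 1 ≤ j + 1 by omega)]
    field_simp

/-- The integrand is nonnegative with primitive `G = h_j^(α+1) / (-(α+1))`. Since `G ≥ 0` when `α <
-1`, its integral over `(ε, 1]` is at most `G 1`, uniformly in `ε`. -/
theorem integrableOn_iterLog {α : ℝ} (hα : α < -1) {j : ℕ} (hj : 1 ≤ j) :
    IntegrableOn (fun r : ℝ => r⁻¹ * iterLog j (r : ℂ) ^ α *
      ∏ k ∈ Finset.Ico 1 j, (iterLog k (r : ℂ) + 1)⁻¹) (Ioc 0 1) := by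
  set φ : ℝ → ℝ := fun r => r⁻¹ * iterLog j (r : ℂ) ^ α *
      ∏ k ∈ Finset.Ico 1 j, (iterLog k (r : ℂ) + 1)⁻¹ with hφ
  set G : ℝ → ℝ := fun r => iterLog j (r : ℂ) ^ (α + 1) / (-(α + 1)) with hG
  have hα1 : 0 < -(α + 1) := by linarith
  have hge : ∀ r ∈ Ioc (0 : ℝ) 1, ∀ k, 1 ≤ iterLog k (r : ℂ) := fun r hr k =>
    one_le_iterLog (by simpa [abs_of_pos hr.1] using hr.2) k
  have hder : ∀ r ∈ Ioc (0 : ℝ) 1, HasDerivAt G (φ r) r := fun r hr => by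
    have hpos : iterLog j (r : ℂ) ≠ 0 := by linarith [hge r hr j]
    refine (((hasDerivAt_iterLog hr.1 hr.2 j hj).rpow_const (p := α + 1)
      (Or.inl hpos)).div_const _).congr_deriv ?_
    have : α + 1 ≠ 0 := by linarith
    rw [hφ, add_sub_cancel_right]
    field_simp
  have hφ0 : ∀ r ∈ Ioc (0 : ℝ) 1, 0 ≤ φ r := fun r hr => by
    have h := hge r hr
    refine mul_nonneg (mul_nonneg (inv_nonneg.2 hr.1.le) (rpow_nonneg (by linarith [h j]) _))
      (Finset.prod_nonneg fun k _ => inv_nonneg.2 (by linarith [h k]))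
  have hG0 : ∀ r ∈ Ioc (0 : ℝ) 1, 0 ≤ G r := fun r hr =>
    div_nonneg (rpow_nonneg (by linarith [hge r hr j]) _) hα1.le
  set ε : ℕ → ℝ := fun n => 1 / ((n : ℝ) + 1) with hε
  have hεpos : ∀ n, 0 < ε n := fun n => by positivity
  have hεle : ∀ n, ε n ≤ 1 := fun n => by
    rw [hε, div_le_one (by positivity)]
    have : (0 : ℝ) ≤ n := by positivity
    linarith
  have hmem : ∀ n, ∀ r ∈ Icc (ε n) 1, r ∈ Ioc (0 : ℝ) 1 := fun n r hr =>
    ⟨(hεpos n).trans_le hr.1, hr.2⟩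
  have hint : ∀ n, IntegrableOn φ (Ioc (ε n) 1) := fun n =>
    intervalIntegral.integrableOn_deriv_of_nonneg
      (fun r hr => (hder r (hmem n r hr)).continuousAt.continuousWithinAt)
      (fun r hr => hder r (hmem n r (Ioo_subset_Icc_self hr)))
      (fun r hr => hφ0 r (hmem n r (Ioo_subset_Icc_self hr)))
  refine integrableOn_Ioc_of_intervalIntegral_norm_bounded_left (I := G 1) (l := Filter.atTop)
    (a := ε) (f := φ) (a₀ := 0) (b := 1) hint tendsto_one_div_add_atTop_nhds_zero_nat
    (Filter.Eventually.of_forall fun n => ?_)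
  rw [← intervalIntegral.integral_of_le (hεle n)]
  have hcongr : ∫ r in ε n..1, ‖φ r‖ = ∫ r in ε n..1, φ r := by
    refine intervalIntegral.integral_congr fun r hr => ?_
    rw [uIcc_of_le (hεle n)] at hr
    exact norm_of_nonneg (hφ0 r (hmem n r hr))
  rw [hcongr, intervalIntegral.integral_eq_sub_of_hasDerivAt (f := G)]
  · linarith [hG0 (ε n) ⟨hεpos n, hεle n⟩]
  · intro r hr
    rw [uIcc_of_le (hεle n)] at hr
    exact hder r (hmem n r hr)
  · rw [intervalIntegrable_iff_integrableOn_Ioc_of_le (hεle n)]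
    exact hint n

/-- The weight `f_{α,j}` is integrable over the disc when `α < -1`. -/
theorem lintegral_logWeight_ne_top {α : ℝ} (hα : α < -1) {j : ℕ} (hj : 1 ≤ j) :
    ∫⁻ w, ENNReal.ofReal (logWeight α j w) ∂unitDiskMeasure ≠ ∞ := by
  rw [unitDiskMeasure, setLIntegral_unitDisk_polar (g := fun w => ENNReal.ofReal (logWeight α j w))
    (ENNReal.measurable_ofReal.comp (measurable_logWeight α j))]
  have hfin := (integrableOn_iterLog hα hj).2
  set φ : ℝ → ℝ := fun r => r⁻¹ * iterLog j (r : ℂ) ^ α *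
      ∏ k ∈ Finset.Ico 1 j, (iterLog k (r : ℂ) + 1)⁻¹ with hφ
  have hle : ∀ r ∈ Ioo (0 : ℝ) 1, ENNReal.ofReal r *
      ∫⁻ θ in Ioo (-π) π, ENNReal.ofReal (logWeight α j (circleMap 0 r θ)) ≤
      ENNReal.ofReal (2 * π * 2 ^ (j - 1)) * ‖φ r‖ₑ := fun r hr => by
    have hn : ‖(r : ℂ)‖ = r := by simp [abs_of_pos hr.1]
    have h : ∀ k, 1 ≤ iterLog k (r : ℂ) := one_le_iterLog (by rw [hn]; exact hr.2.le)
    have e : ∀ θ, logWeight α j (circleMap 0 r θ) = logWeight α j (r : ℂ) := fun θ =>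
      logWeight_congr_norm (by simp) α j
    have hpow : 0 ≤ iterLog j (r : ℂ) ^ α := rpow_nonneg (by linarith [h j]) _
    -- Since `h_k ≥ 1`, `h_k + 1 ≤ 2 h_k`: each of the `j - 1` factors costs at most `2`.
    have hprod : ∏ k ∈ Finset.Ico 1 j, (iterLog k (r : ℂ))⁻¹ ≤
        2 ^ (j - 1) * ∏ k ∈ Finset.Ico 1 j, (iterLog k (r : ℂ) + 1)⁻¹ := by
      rw [← Nat.card_Ico, ← Finset.prod_const, ← Finset.prod_mul_distrib]
      refine Finset.prod_le_prod (fun k _ => inv_nonneg.2 (by linarith [h k])) fun k _ => ?_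
      have := h k
      rw [← div_eq_mul_inv, inv_eq_one_div, div_le_div_iff₀ (by linarith) (by linarith)]
      linarith
    simp only [e, lintegral_const, Measure.restrict_apply_univ, Real.volume_Ioo]
    rw [← ENNReal.ofReal_mul' (by linarith [pi_pos]), ← ENNReal.ofReal_mul hr.1.le,
      ← ofReal_norm, ← ENNReal.ofReal_mul (by positivity)]
    refine ENNReal.ofReal_le_ofReal ?_
    refine le_trans ?_ (mul_le_mul_of_nonneg_left (le_abs_self (φ r)) (by positivity))
    have hr0 := hr.1
    calc r * (logWeight α j (r : ℂ) * (π - -π))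
        = 2 * π * (r⁻¹ * iterLog j (r : ℂ) ^ α *
            ∏ k ∈ Finset.Ico 1 j, (iterLog k (r : ℂ))⁻¹) := by
          rw [logWeight, hn]; field_simp; ring
      _ ≤ 2 * π * (r⁻¹ * iterLog j (r : ℂ) ^ α *
            (2 ^ (j - 1) * ∏ k ∈ Finset.Ico 1 j, (iterLog k (r : ℂ) + 1)⁻¹)) := by
          have := pi_pos
          gcongr
      _ = _ := by rw [hφ]; ring
  refine ne_top_of_le_ne_top ?_ (setLIntegral_mono' measurableSet_Ioo hle)
  rw [lintegral_const_mul' _ _ ENNReal.ofReal_ne_top]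
  refine ENNReal.mul_ne_top ENNReal.ofReal_ne_top (ne_top_of_le_ne_top hfin.ne ?_)
  exact lintegral_mono_set Ioo_subset_Ioc_self
end LogWeight

/-! ### Transfer of the weighted estimate to the Hartogs triangle. -/

section WeakType
open Metric Set Real

theorem measurable_hartogsWeight (α : ℝ) (j : ℕ) : Measurable fun z : ℂ × ℂ =>
    ENNReal.ofReal ((‖z.2‖ ^ 2 * logWeight α j z.2) ^ (-(1 / 3) : ℝ)) :=
  ENNReal.measurable_ofReal.comp
    ((((measurable_snd.norm).pow_const 2).mul
      ((measurable_logWeight α j).comp measurable_snd)).pow_const _)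

theorem absolutelyContinuous_hartogsWeightedMeasure (α : ℝ) (j : ℕ) :
    volume.restrict hartogsTriangle ≪ hartogsWeightedMeasure α j := by
  refine withDensity_absolutelyContinuous' (measurable_hartogsWeight α j).aemeasurable ?_
  filter_upwards [ae_restrict_mem measurableSet_hartogsTriangle] with z hz
  have h0 := snd_ne_zero_of_mem_hartogsTriangle hz
  have h1 := logWeight_pos hz.2 h0 α j
  have h2 := norm_pos_iff.2 h0
  rw [ne_eq, ENNReal.ofReal_eq_zero, not_le]
  positivity

/-- The Jacobian `|v|²` and the weight factor `|v|^(-2/3)` combine to `|v|^(4/3)`, exactly the power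
carried by the pullback. -/
theorem lintegral_hartogsWeightedMeasure (α : ℝ) (j : ℕ) {f : ℂ × ℂ → ℂ}
    (hf : AEStronglyMeasurable f (volume.restrict hartogsTriangle)) :
    ∫⁻ z, ‖f z‖ₑ ^ (4 / 3 : ℝ) ∂hartogsWeightedMeasure α j =
      ∫⁻ x, ‖hartogsPullback f x‖ₑ ^ (4 / 3 : ℝ) *
        ENNReal.ofReal (logWeight α j x.2) ^ (-(1 / 3) : ℝ) ∂bidiskMeasure := by
  rw [hartogsWeightedMeasure, lintegral_withDensity_eq_lintegral_mul₀
    (measurable_hartogsWeight α j).aemeasurable (hf.enorm.pow_const _),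
    lintegral_hartogsTriangle₀ ((measurable_hartogsWeight α j).aemeasurable.mul
      (hf.enorm.pow_const _))]
  refine lintegral_congr_ae ?_
  filter_upwards [ae_bidiskMeasure_mem] with x hx
  have hv := norm_pos_iff.2 hx.2.2
  have hL := logWeight_pos hx.2.1 hx.2.2 α j
  have hb0 : ‖x.2‖ₑ ≠ 0 := enorm_ne_zero.2 hx.2.2
  have hbt : ‖x.2‖ₑ ≠ ∞ := enorm_ne_top
  simp only [Pi.mul_apply, hartogsPullback, enorm_mul]
  have e1 : ENNReal.ofReal ((‖(hartogsMap x).2‖ ^ 2 * logWeight α j (hartogsMap x).2) ^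
      (-(1 / 3) : ℝ)) = ‖x.2‖ₑ ^ (-(2 / 3) : ℝ) *
        ENNReal.ofReal (logWeight α j x.2) ^ (-(1 / 3) : ℝ) := by
    simp only [hartogsMap]
    rw [← ENNReal.ofReal_rpow_of_pos (by positivity), ENNReal.ofReal_mul (by positivity),
      ENNReal.mul_rpow_of_ne_top (by simp) (by simp), ENNReal.ofReal_pow (norm_nonneg _),
      ofReal_norm, ← ENNReal.rpow_natCast, ← ENNReal.rpow_mul]
    norm_num
  have e2 : ((‖x.2‖₊ ^ 2 : ℝ≥0) : ℝ≥0∞) = ‖x.2‖ₑ ^ (2 : ℝ) := by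
    rw [ENNReal.rpow_ofNat, ENNReal.coe_pow, enorm_eq_nnnorm]
  rw [e1, e2, ENNReal.mul_rpow_of_nonneg _ _ (by norm_num),
    show (4 / 3 : ℝ) = 2 + -(2 / 3) by norm_num, ENNReal.rpow_add _ _ hb0 hbt]
  ring

/-- Hölder with exponents `4/3` and `4` for `|F| = (|F| L^(-1/4)) · L^(1/4)`. With `L` integrable,
it places the pullback in L¹. -/
theorem lintegral_enorm_le_of_logWeight (α : ℝ) (j : ℕ) {F : ℂ × ℂ → ℂ}
    (hF : AEStronglyMeasurable F bidiskMeasure) :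
    ∫⁻ x, ‖F x‖ₑ ∂bidiskMeasure ≤
      (∫⁻ x, ‖F x‖ₑ ^ (4 / 3 : ℝ) *
        ENNReal.ofReal (logWeight α j x.2) ^ (-(1 / 3) : ℝ) ∂bidiskMeasure) ^ (1 / (4 / 3) : ℝ) *
      (∫⁻ x, ENNReal.ofReal (logWeight α j x.2) ∂bidiskMeasure) ^ (1 / 4 : ℝ) := by
  have hL : Measurable fun x : ℂ × ℂ => ENNReal.ofReal (logWeight α j x.2) :=
    ENNReal.measurable_ofReal.comp ((measurable_logWeight α j).comp measurable_snd)
  have h := ENNReal.lintegral_mul_le_Lp_mul_Lq bidiskMeasure holderConjugate_four_thirds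
    (f := fun x => ‖F x‖ₑ * ENNReal.ofReal (logWeight α j x.2) ^ (-(1 / 4) : ℝ))
    (g := fun x => ENNReal.ofReal (logWeight α j x.2) ^ (1 / 4 : ℝ))
    (hF.enorm.mul (hL.pow_const _).aemeasurable) (hL.pow_const _).aemeasurable
  have e1 : ∀ x, (‖F x‖ₑ * ENNReal.ofReal (logWeight α j x.2) ^ (-(1 / 4) : ℝ)) ^ (4 / 3 : ℝ) =
      ‖F x‖ₑ ^ (4 / 3 : ℝ) * ENNReal.ofReal (logWeight α j x.2) ^ (-(1 / 3) : ℝ) := fun x => by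
    rw [ENNReal.mul_rpow_of_nonneg _ _ (by norm_num), ← ENNReal.rpow_mul]; norm_num
  have e2 : ∀ x : ℂ × ℂ, (ENNReal.ofReal (logWeight α j x.2) ^ (1 / 4 : ℝ)) ^ (4 : ℝ) =
      ENNReal.ofReal (logWeight α j x.2) := fun x => by
    rw [← ENNReal.rpow_mul]; norm_num
  simp only [e1, e2] at h
  refine le_trans (lintegral_mono_ae ?_) h
  filter_upwards [ae_bidiskMeasure_mem] with x hx
  have hpos := logWeight_pos hx.2.1 hx.2.2 α j
  rw [Pi.mul_apply, mul_assoc, ← ENNReal.rpow_add _ _ (by simpa using hpos) (by simp)]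
  simp

theorem integrable_hartogsPullback {α : ℝ} (hα : α < -1) {j : ℕ} (hj : 1 ≤ j) {f : ℂ × ℂ → ℂ}
    (hf : AEStronglyMeasurable f (volume.restrict hartogsTriangle))
    (hfin : ∫⁻ z, ‖f z‖ₑ ^ (4 / 3 : ℝ) ∂hartogsWeightedMeasure α j ≠ ∞) :
    Integrable (hartogsPullback f) bidiskMeasure := by
  refine ⟨aestronglyMeasurable_hartogsPullback hf, ?_⟩
  refine (lintegral_enorm_le_of_logWeight α j
    (aestronglyMeasurable_hartogsPullback hf)).trans_lt (ENNReal.mul_lt_top ?_ ?_)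
  · rw [← lintegral_hartogsWeightedMeasure α j hf]
    exact ENNReal.rpow_lt_top_of_nonneg (by norm_num) hfin
  · refine ENNReal.rpow_lt_top_of_nonneg (by norm_num) ?_
    have hL : Measurable fun w : ℂ => ENNReal.ofReal (logWeight α j w) :=
      ENNReal.measurable_ofReal.comp (measurable_logWeight α j)
    have h := lintegral_prod_mul (μ := unitDiskMeasure) (ν := unitDiskMeasure)
      (f := fun _ => 1) aemeasurable_const hL.aemeasurable
    simp only [one_mul, lintegral_one] at h
    rw [bidiskMeasure, h]
    exact ENNReal.mul_ne_top (measure_ne_top _ _) (lintegral_logWeight_ne_top hα hj)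

/-- The weighted `L^{4/3}` estimate for the projection of the bidisc. -/
theorem exists_lintegral_bidiskProjection_le {α : ℝ} (hα : α < -1) {j : ℕ} (hj : 1 ≤ j) :
    ∃ C : ℝ≥0, ∀ F : ℂ × ℂ → ℂ, AEStronglyMeasurable F bidiskMeasure →
      ∫⁻ x, ‖bidiskProjection F x‖ₑ ^ (4 / 3 : ℝ) ∂bidiskMeasure ≤
        C * ∫⁻ x, ‖F x‖ₑ ^ (4 / 3 : ℝ) *
          ENNReal.ofReal (logWeight α j x.2) ^ (-(1 / 3) : ℝ) ∂bidiskMeasure := by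
  obtain ⟨C, hC⟩ := (diskSchurWeights_one holderConjugate_four_thirds).bidisk
    holderConjugate_four_thirds (diskSchurWeights_of_integrable
      (f := fun w => ENNReal.ofReal (logWeight α j w))
      (ENNReal.measurable_ofReal.comp (measurable_logWeight α j))
      (fun w hw h0 => by simpa using logWeight_pos hw h0 α j) (fun w => ENNReal.ofReal_ne_top)
      (fun w hw h2 => by
        rw [show (4 : ℝ≥0∞) = ENNReal.ofReal 4 by simp]
        exact ENNReal.ofReal_le_ofReal (logWeight_le_four hw h2 (by linarith) j))
      (lintegral_logWeight_ne_top hα hj))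
  refine ⟨C, fun F hF => ?_⟩
  have h := hC (fun y => ‖F y‖ₑ) hF.enorm
  simp only [one_mul] at h
  refine (lintegral_mono fun x => ?_).trans h
  exact ENNReal.rpow_le_rpow (enorm_bidiskProjection_le F x) (by norm_num)

theorem bergmanProjection_hartogsTriangle {f : ℂ × ℂ → ℂ}
    (hf : AEStronglyMeasurable f (volume.restrict hartogsTriangle)) {z : ℂ × ℂ}
    (hz : z ∈ hartogsTriangle) :
    bergmanProjection hartogsTriangle f z =
      z.2⁻¹ * bidiskProjection (hartogsPullback f) (z.1 / z.2, z.2) := by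
  rw [bergmanProjection, integral_congr_ae (bergmanKernel_mul_ae_eq hz f),
    setIntegral_hartogsKernel_mul hf]

/-- The Jacobian `|v|²` against the factor `|v|^(-4/3)` from `z.2⁻¹` leaves `|v|^(2/3) ≤ 1`, which
is discarded. -/
theorem lintegral_bergmanProjection_le {f : ℂ × ℂ → ℂ}
    (hf : AEStronglyMeasurable f (volume.restrict hartogsTriangle))
    (hP : AEStronglyMeasurable (bergmanProjection hartogsTriangle f)
      (volume.restrict hartogsTriangle)) :
    ∫⁻ z in hartogsTriangle, ‖bergmanProjection hartogsTriangle f z‖ₑ ^ (4 / 3 : ℝ) ≤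
      ∫⁻ x, ‖bidiskProjection (hartogsPullback f) x‖ₑ ^ (4 / 3 : ℝ) ∂bidiskMeasure := by
  rw [lintegral_hartogsTriangle₀ (hP.enorm.pow_const _)]
  refine lintegral_mono_ae ?_
  filter_upwards [ae_bidiskMeasure_mem] with x hx
  have hb0 : ‖x.2‖ₑ ≠ 0 := enorm_ne_zero.2 hx.2.2
  have hbt : ‖x.2‖ₑ ≠ ∞ := enorm_ne_top
  have hb1 : ‖x.2‖ₑ ≤ 1 := by
    rw [← ofReal_norm, ENNReal.ofReal_le_one]; exact hx.2.1.le
  have e2 : ((‖x.2‖₊ ^ 2 : ℝ≥0) : ℝ≥0∞) = ‖x.2‖ₑ ^ (2 : ℝ) := by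
    rw [ENNReal.rpow_ofNat, ENNReal.coe_pow, enorm_eq_nnnorm]
  rw [bergmanProjection_hartogsTriangle hf (hartogsMap_mem hx.1 hx.2.1 hx.2.2), e2]
  simp only [hartogsMap, mul_div_cancel_right₀ _ hx.2.2, Prod.mk.eta]
  rw [enorm_mul, enorm_inv hx.2.2, ENNReal.mul_rpow_of_nonneg _ _ (by norm_num), ← mul_assoc,
    ENNReal.inv_rpow, ← ENNReal.rpow_neg, ← ENNReal.rpow_add _ _ hb0 hbt]
  exact mul_le_of_le_one_left zero_le (ENNReal.rpow_le_one hb1 (by norm_num))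
end WeakType

/-! ### The main theorem. -/

theorem theorem4p9 :
    -- the Bergman kernel of the Hartogs triangle exists
    IsBergmanKernel hartogsTriangle (bergmanKernel hartogsTriangle) ∧
    ∀ α : ℝ, α < -1 → ∀ j : ℕ, 1 ≤ j →
      ∃ C : ℝ≥0, ∀ f : ℂ × ℂ → ℂ, MemLp f (4 / 3) (hartogsWeightedMeasure α j) →
        -- the integral defining `P f` converges absolutely, and `P f` is measurable
        (∀ z ∈ hartogsTriangle,
          IntegrableOn (fun w => bergmanKernel hartogsTriangle z w * f w) hartogsTriangle) ∧
        AEStronglyMeasurable (bergmanProjection hartogsTriangle f)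
          (volume.restrict hartogsTriangle) ∧
        -- the weak-type estimate
        ∀ t : ℝ, 0 < t →
          volume {z ∈ hartogsTriangle | t < ‖bergmanProjection hartogsTriangle f z‖} ≤
            C * eLpNorm f (4 / 3) (hartogsWeightedMeasure α j) ^ (4 / 3 : ℝ)
              / ENNReal.ofReal t ^ (4 / 3 : ℝ) := by
  refine ⟨isBergmanKernel_bergmanKernel, fun α hα j hj => ?_⟩
  obtain ⟨C, hC⟩ := exists_lintegral_bidiskProjection_le hα hj
  refine ⟨C, fun f hf => ?_⟩
  have hfm : AEStronglyMeasurable f (volume.restrict hartogsTriangle) :=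
    hf.1.mono_ac (absolutelyContinuous_hartogsWeightedMeasure α j)
  have hexp : (4 / 3 : ℝ≥0∞).toReal = 4 / 3 := by simp
  have hp0 : (4 / 3 : ℝ≥0∞) ≠ 0 := by simp
  have hpt : (4 / 3 : ℝ≥0∞) ≠ ∞ := ENNReal.div_ne_top (by simp) (by simp)
  have hnorm : eLpNorm f (4 / 3) (hartogsWeightedMeasure α j) ^ (4 / 3 : ℝ) =
      ∫⁻ z, ‖f z‖ₑ ^ (4 / 3 : ℝ) ∂hartogsWeightedMeasure α j := by
    rw [eLpNorm_eq_lintegral_rpow_enorm_toReal hp0 hpt, hexp, ← ENNReal.rpow_mul]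
    norm_num
  have hfin : ∫⁻ z, ‖f z‖ₑ ^ (4 / 3 : ℝ) ∂hartogsWeightedMeasure α j ≠ ∞ := by
    rw [← hnorm]
    exact ENNReal.rpow_ne_top_of_nonneg (by norm_num) hf.2.ne
  have hF := integrable_hartogsPullback hα hj hfm hfin
  -- The projection agrees on the triangle with a holomorphic function, as the pullback of `f` is
  -- integrable; measurability follows from continuity.
  have hP : AEStronglyMeasurable (bergmanProjection hartogsTriangle f)
      (volume.restrict hartogsTriangle) :=
    ((differentiableOn_inv_mul_bidiskProjection hF).continuousOn.congr fun z hz =>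
      bergmanProjection_hartogsTriangle hfm hz).aestronglyMeasurable measurableSet_hartogsTriangle
  refine ⟨fun z hz => (integrableOn_hartogsKernel_mul hfm hF hz).congr
    (bergmanKernel_mul_ae_eq hz f).symm, hP, fun t ht => ?_⟩
  have hbound : ∫⁻ z in hartogsTriangle, ‖bergmanProjection hartogsTriangle f z‖ₑ ^ (4 / 3 : ℝ) ≤
      C * eLpNorm f (4 / 3) (hartogsWeightedMeasure α j) ^ (4 / 3 : ℝ) := by
    rw [hnorm, lintegral_hartogsWeightedMeasure α j hfm]
    exact (lintegral_bergmanProjection_le hfm hP).trans (hC _ hF.1)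
  have ht0 : ENNReal.ofReal t ^ (4 / 3 : ℝ) ≠ 0 := by
    simp [ENNReal.rpow_eq_zero_iff, ht]
  have htt : ENNReal.ofReal t ^ (4 / 3 : ℝ) ≠ ∞ :=
    ENNReal.rpow_ne_top_of_nonneg (by norm_num) ENNReal.ofReal_ne_top
  refine le_trans ?_ (ENNReal.div_le_div_right hbound _)
  -- Chebyshev for the `4/3` power, at level `t^(4/3)`.
  refine le_trans ?_ (meas_ge_le_lintegral_div (hP.enorm.pow_const _) ht0 htt)
  rw [Measure.restrict_apply' measurableSet_hartogsTriangle]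
  refine measure_mono fun z hz => ⟨?_, hz.1⟩
  refine ENNReal.rpow_le_rpow ?_ (by norm_num)
  rw [← ofReal_norm]
  exact ENNReal.ofReal_le_ofReal hz.2.le
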